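/- There exist numerical constants $C^{(2)},C^{(3)}>0$ such that the following holds. Let $k\ge 2$ be an integer, $0<\rho<1$, and let $\mu_0,\mu_1,\dots,\mu_k$ be probability distributions on the same measurable space $\Omega$ such that $(1-\rho)\mu_0(E)\le \mu_i(E)\le (1+\rho)\mu_0(E)$ for every event $E$ and every $1\le i\le k$. Assume that there is an integer $n\ge 1$ with $n\le C^{(2)}/(\rho^2\log k)$ and \[ \sum_{S\subseteq\{1,\dots,k\},\ |S|\ge 2} n^{-|S|/2}\rho^{-|S|}\left|\mathbb{E}_{A\sim\mu_0}\prod_{i\in S}\left(\frac{d\mu_i}{d\mu_0}(A)-1\right)\right|\le \frac1n . \] Let $t,s,\ell\ge 1$ be integers, and consider any algorithm that makes $\ell$ passes over $t$ samples with $s$ bits of memory: for $x_1,\dots,x_t\in\Omega$ it starts from a fixed $u_1\in\{0,1\}^s$, computes $u_{j+1}=f_j(y_j,u_j)\in\{0,1\}^s$ for $1\le j\le t\ell$, where $y_1,\dots,y_{t\ell}$ consists of $\ell$ consecutive copies of $x_1,\dots,x_t$ and the $f_j$ are arbitrary (measurable) functions, and outputs an element of $\{1,\dots,k\}$ that is a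 function of $u_{t\ell+1}$. If, for every $1\le i\le k$, the algorithm outputs $i$ with probability at least $2/3$ when $x_1,\dots,x_t$ are drawn i.i.d. from $\mu_i$, then \[ ts\ell\ \ge\ \frac{k}{C^{(3)}\rho^2\log k}. \] -/

import Mathlib

open MeasureTheory

/-- `μ₁, …, μ_k` (indexed by `Fin k`) is a `ρ`-centered family of distributions, centered
around the distribution `μ₀`. -/
structure IsCenteredFamily {Ω : Type*} [MeasurableSpace Ω] {k : ℕ}
    (ρ : ℝ) (μ₀ : Measure Ω) (μ : Fin k → Measure Ω) : Prop where
  two_le : 2 ≤ k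
  rho_pos : 0 < ρ
  rho_lt_one : ρ < 1
  prob_center : IsProbabilityMeasure μ₀
  prob : ∀ i, IsProbabilityMeasure (μ i)
  lower : ∀ i, ∀ E, MeasurableSet E → (1 - ρ) * μ₀.real E ≤ (μ i).real E
  upper : ∀ i, ∀ E, MeasurableSet E → (μ i).real E ≤ (1 + ρ) * μ₀.real E

/-- The mixed central moment `𝔼_{A ∼ μ₀} ∏_{i ∈ S} (μ_i(A) / μ₀(A) - 1)`, where
`μ_i(A) / μ₀(A)` is the density (Radon–Nikodym derivative) of `μ_i` with respect to `μ₀`. -/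
noncomputable def highOrderCorr {Ω : Type*} [MeasurableSpace Ω] {k : ℕ}
    (μ₀ : Measure Ω) (μ : Fin k → Measure Ω) (S : Finset (Fin k)) : ℝ :=
  ∫ A, ∏ i ∈ S, (((μ i).rnDeriv μ₀ A).toReal - 1) ∂μ₀

/-- `∑_{S ⊆ [k], |S| ≥ 2} n^{-|S|/2} ρ^{-|S|} |𝔼_{A ∼ μ₀} ∏_{i ∈ S} (μ_i(A)/μ₀(A) - 1)| ≤ 1/n`. -/
def ApproxUncorrelated {Ω : Type*} [MeasurableSpace Ω] {k : ℕ}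
    (ρ : ℝ) (μ₀ : Measure Ω) (μ : Fin k → Measure Ω) (n : ℕ) : Prop :=
  ∑ S : Finset (Fin k) with 2 ≤ S.card,
    (n : ℝ) ^ (-(S.card : ℝ) / 2) * ρ ^ (-(S.card : ℝ)) * |highOrderCorr μ₀ μ S| ≤ 1 / (n : ℝ)

/-- An algorithm with `s` bits of memory processing a stream of points of `Ω` and producing an
index in `[k]`: an initial memory, an arbitrary (measurable) update function `f_j` for each time
step `j`, and an output that is a function of the final memory. -/
structure StreamAlg (Ω : Type*) [MeasurableSpace Ω] (s k : ℕ) where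
  init : Fin s → Bool
  step : ℕ → Ω → (Fin s → Bool) → (Fin s → Bool)
  measurable_step : ∀ j u, Measurable fun x => step j x u
  output : (Fin s → Bool) → Fin k

namespace StreamAlg

variable {Ω : Type*} [MeasurableSpace Ω] {s k : ℕ}

/-- The memory after the first `j` elements of a stream `y 0, y 1, …`. -/
def memory (A : StreamAlg Ω s k) (y : ℕ → Ω) : ℕ → (Fin s → Bool)
  | 0 => A.init
  | j + 1 => A.step j (y j) (A.memory y j)

/-- The output after `ℓ` passes, each going in order over the `t` data points `x`: the `j`-th
element of the stream (counting from `0`) is the data point with index `j % t`. -/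
def run (A : StreamAlg Ω s k) {t : ℕ} (ht : 1 ≤ t) (ℓ : ℕ) (x : Fin t → Ω) : Fin k :=
  A.output (A.memory (fun j => x ⟨j % t, Nat.mod_lt j ht⟩) (t * ℓ))

/-- `A`, making `ℓ` passes over `t` i.i.d. samples, identifies `μ₁, …, μ_k` with error `ε`:
for every `i`, if the samples come from `μ_i` then the output is `i` with probability at least
`1 - ε`. -/
def Identifies (A : StreamAlg Ω s k) {t : ℕ} (ht : 1 ≤ t) (ℓ : ℕ)
    (μ : Fin k → Measure Ω) (ε : ℝ) : Prop :=
  ∀ i, 1 - ε ≤ (Measure.pi fun _ : Fin t => μ i).real {x | A.run ht ℓ x = i}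

end StreamAlg

/-!
Write `μ i` as the measure with density `1 + ρ g i` with respect to `μ₀`, where `|g i| ≤ 1` and
`g i` has mean zero. Cut the sample into blocks of length `n` and record the memory states at the
block ends: the inputs leading to a given transcript form a product set in the blocks, so that a
transcript can be treated one block at a time. Within a block the assumption on the high-order
correlations says that the moments of the normalised sums `n ^ (-1 / 2) ∑ j, g i (x j)` nearly
factorise over `i`. Their joint exponential moments are therefore those of independent variables,
up to a constant, and an event of probability `p` carries information at most
`O (n ρ ^ 2 log k (1 + log (1 / p)))` about all `k` hypotheses together. Summing over blocks and
transcripts bounds the total divergence by `O (n ρ ^ 2 log k)` times `s ℓ t / n`, while identifying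
the hypothesis forces a divergence bounded below for each of the `k` hypotheses.
-/

/-! ### Elementary inequalities -/

theorem exp_le_one_add_add_sq_mul_exp (x : ℝ) :
    Real.exp x ≤ 1 + x + x ^ 2 * Real.exp (max x 0) := by
  have one_sub_mul_exp_le : (1 - x) * Real.exp x ≤ 1 := calc
    (1 - x) * Real.exp x ≤ Real.exp (-x) * Real.exp x := by
      gcongr; exact Real.one_sub_le_exp_neg x
    _ = 1 := by rw [← Real.exp_add, neg_add_cancel, Real.exp_zero]
  rcases le_total x 0 with hx | hx
  · rw [max_eq_right hx, Real.exp_zero, mul_one]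
    have one_le : (1 : ℝ) ≤ (1 - x) * (1 + x + x ^ 2) := by
      nlinarith [mul_nonneg (sq_nonneg x) (neg_nonneg.2 hx)]
    exact le_of_mul_le_mul_left (one_sub_mul_exp_le.trans one_le) (by linarith)
  · rw [max_eq_left hx]
    nlinarith [Real.one_le_exp hx]

theorem sq_le_mul_exp_div_eight {w : ℝ} (hw : 0 ≤ w) : w ^ 2 ≤ 128 * Real.exp (w / 8) := by
  have := Real.quadratic_le_exp_of_nonneg (x := w / 8) (by positivity)
  nlinarith

theorem exp_half_le_two : Real.exp (1 / 2) ≤ 2 := by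
  have := Real.exp_bound_div_one_sub_of_interval (x := 1 / 2) (by norm_num) (by norm_num)
  norm_num at this ⊢
  exact this

theorem sub_two_mul_sq_le_log_one_add {x : ℝ} (hx : -(1 / 2) ≤ x) :
    x - 2 * x ^ 2 ≤ Real.log (1 + x) := by
  have hpos : 0 < 1 + x := by linarith
  have hnum : 0 ≤ 1 + 2 * x := by linarith
  refine le_trans ?_ (Real.one_sub_inv_le_log_of_pos hpos)
  rw [← sub_nonneg]
  have : 1 - (1 + x)⁻¹ - (x - 2 * x ^ 2) = x ^ 2 * (1 + 2 * x) / (1 + x) := by field_simp; ring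
  rw [this]
  positivity

theorem sub_one_le_mul_of_abs_log_le {L a : ℝ} (hL : 0 < L) (h : |Real.log L| ≤ a) :
    L - 1 ≤ a * L := by
  rw [← div_le_iff₀ hL]
  calc (L - 1) / L = 1 - L⁻¹ := by field_simp
    _ ≤ Real.log L := Real.one_sub_inv_le_log_of_pos hL
    _ ≤ a := (le_abs_self _).trans h

theorem neg_le_sub_one_of_abs_log_le {L a : ℝ} (hL : 0 < L) (h : |Real.log L| ≤ a) :
    -a ≤ L - 1 :=
  (abs_le.1 h).1.trans (Real.log_le_sub_one_of_pos hL)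

theorem abs_min_sub_one_le {L a : ℝ} (hL : 0 < L) (h : |Real.log L| ≤ a) :
    |min (L - 1) 1| ≤ 2 * a := by
  have ha : 0 ≤ a := (abs_nonneg _).trans h
  have hlow := neg_le_sub_one_of_abs_log_le hL h
  have hup := sub_one_le_mul_of_abs_log_le hL h
  rw [abs_le]
  refine ⟨le_min (by linarith) (by linarith), ?_⟩
  rcases le_total L 2 with h2 | h2
  · exact (min_le_left _ _).trans (by nlinarith)
  · exact (min_le_right _ _).trans (by nlinarith)

theorem abs_sub_one_le_mul_exp {L a : ℝ} (hL : 0 < L) (h : |Real.log L| ≤ a) :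
    |L - 1| ≤ a * Real.exp a := by
  have ha : 0 ≤ a := (abs_nonneg _).trans h
  have hlow := neg_le_sub_one_of_abs_log_le hL h
  have hup := sub_one_le_mul_of_abs_log_le hL h
  have hLa : L ≤ Real.exp a := (Real.log_le_iff_le_exp hL).1 ((le_abs_self _).trans h)
  rw [abs_le]
  exact ⟨by nlinarith [Real.one_le_exp ha], hup.trans (by gcongr)⟩

theorem exp_le_of_abs_le_mul_exp {x l w : ℝ} (hw : 0 ≤ w)
    (hx : |x| ≤ 2 * l * w * Real.exp (w / 16)) (hx' : x ≤ w / 8) :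
    Real.exp x ≤ 1 + x + 512 * l ^ 2 * Real.exp (w / 2) := by
  have hmax : max x 0 ≤ w / 8 := max_le hx' (by positivity)
  have hsq : x ^ 2 ≤ 512 * l ^ 2 * Real.exp (w / 4) := calc
    x ^ 2 = |x| ^ 2 := (sq_abs x).symm
    _ ≤ (2 * l * w * Real.exp (w / 16)) ^ 2 := by gcongr
    _ = 4 * l ^ 2 * w ^ 2 * Real.exp (w / 16 + w / 16) := by rw [Real.exp_add]; ring
    _ ≤ 4 * l ^ 2 * (128 * Real.exp (w / 8)) * Real.exp (w / 16 + w / 16) := by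
      gcongr; exact sq_le_mul_exp_div_eight hw
    _ = 512 * l ^ 2 * Real.exp (w / 8 + (w / 16 + w / 16)) := by
      rw [Real.exp_add (w / 8)]; ring
    _ = 512 * l ^ 2 * Real.exp (w / 4) := by ring_nf
  calc Real.exp x ≤ 1 + x + x ^ 2 * Real.exp (max x 0) := exp_le_one_add_add_sq_mul_exp x
    _ ≤ 1 + x + 512 * l ^ 2 * Real.exp (w / 4) * Real.exp (w / 8) := by gcongr
    _ = 1 + x + 512 * l ^ 2 * Real.exp (w / 4 + w / 8) := by rw [Real.exp_add]; ring
    _ ≤ 1 + x + 512 * l ^ 2 * Real.exp (w / 2) := by gcongr; linarith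

theorem exp_mul_min_sub_one_le {L w ε l : ℝ} (hL : 0 < L) (hε : 0 < ε)
    (hl : 0 ≤ l) (hl' : l ≤ 1 / 16) (hw : 0 ≤ w) (hy : |Real.log L| ≤ ε * w) :
    Real.exp (l / ε * min (L - 1) 1) ≤ 1 + l / ε * (L - 1) + 512 * l ^ 2 * Real.exp (w / 2) := by
  have habs : |l / ε * min (L - 1) 1| ≤ 2 * l * w := by
    rw [abs_mul, abs_of_nonneg (by positivity : 0 ≤ l / ε)]
    calc l / ε * |min (L - 1) 1| ≤ l / ε * (2 * (ε * w)) := by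
          gcongr; exact abs_min_sub_one_le hL hy
      _ = 2 * l * w := by field_simp
  have hexp := exp_le_of_abs_le_mul_exp hw
    (habs.trans (le_mul_of_one_le_right (by positivity) (Real.one_le_exp (by positivity))))
    ((le_abs_self _).trans (habs.trans (by nlinarith)))
  have : l / ε * min (L - 1) 1 ≤ l / ε * (L - 1) := by gcongr; exact min_le_left _ _
  linarith

theorem exp_neg_mul_sub_one_le {L w ε l : ℝ} (hL : 0 < L) (hε : 0 < ε) (hε' : ε ≤ 1 / 16)
    (hl : 0 ≤ l) (hl' : l ≤ 1 / 16) (hw : 0 ≤ w) (hy : |Real.log L| ≤ ε * w) :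
    Real.exp (l / ε * (1 - L)) ≤ 1 + l / ε * (1 - L) + 512 * l ^ 2 * Real.exp (w / 2) := by
  refine exp_le_of_abs_le_mul_exp hw ?_ ?_
  · rw [abs_mul, abs_of_nonneg (by positivity : 0 ≤ l / ε), abs_sub_comm]
    calc l / ε * |L - 1| ≤ l / ε * (ε * w * Real.exp (ε * w)) := by
          gcongr; exact abs_sub_one_le_mul_exp hL hy
      _ = l * w * Real.exp (ε * w) := by field_simp
      _ ≤ 2 * l * w * Real.exp (w / 16) := by
          gcongr <;> linarith [mul_le_mul_of_nonneg_right hε' hw]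
  · have := neg_le_sub_one_of_abs_log_le hL hy
    calc l / ε * (1 - L) ≤ l / ε * (ε * w) := by gcongr; linarith
      _ = l * w := by field_simp
      _ ≤ w / 8 := by nlinarith

/-! ### Likelihood ratios of product measures -/

/-- The perturbation `(1 + θ g) μ₀` of the distribution `μ₀`. The members of a `ρ`-centered family
have this form with `θ = ρ` and `|g| ≤ 1`. -/
noncomputable def perturb {Ω : Type*} [MeasurableSpace Ω] (μ₀ : Measure Ω) (θ : ℝ) (g : Ω → ℝ) :
    Measure Ω :=
  μ₀.withDensity fun a => ENNReal.ofReal (1 + θ * g a)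

/-- The likelihood ratio `∏ j, (1 + θ g(x_j))` between `perturb μ₀ θ g` and `μ₀` of i.i.d. samples
`x_j`. -/
noncomputable def likelihood {Ω J : Type*} [Fintype J] (g : Ω → ℝ) (θ : ℝ) (x : J → Ω) : ℝ :=
  ∏ j, (1 + θ * g (x j))

/-- The normalized score `|J|^{-1/2} ∑ j, g(x_j)`, the statistic that governs the first order
behaviour of `likelihood g θ` in `θ`. -/
noncomputable def score {Ω J : Type*} [Fintype J] (g : Ω → ℝ) (x : J → Ω) : ℝ :=
  (∑ j, g (x j)) / √(Fintype.card J)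

section Likelihood

variable {Ω J : Type*} [Fintype J] {g : Ω → ℝ} {θ : ℝ}

theorem abs_mul_le_of_abs_le_one (hg : ∀ a, |g a| ≤ 1) (θ : ℝ) (a : Ω) : |θ * g a| ≤ |θ| := by
  rw [abs_mul]
  exact mul_le_of_le_one_right (abs_nonneg _) (hg a)

theorem one_add_mul_pos (hg : ∀ a, |g a| ≤ 1) (hθ : |θ| ≤ 1 / 2) (a : Ω) : 0 < 1 + θ * g a := by
  linarith [(abs_le.1 ((abs_mul_le_of_abs_le_one hg θ a).trans hθ)).1]

theorem likelihood_pos (hg : ∀ a, |g a| ≤ 1) (hθ : |θ| ≤ 1 / 2) (x : J → Ω) :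
    0 < likelihood g θ x :=
  Finset.prod_pos fun j _ => one_add_mul_pos hg hθ (x j)

theorem abs_likelihood_le (hg : ∀ a, |g a| ≤ 1) (θ : ℝ) (x : J → Ω) :
    |likelihood g θ x| ≤ (1 + |θ|) ^ Fintype.card J := by
  rw [likelihood, Finset.abs_prod, ← Finset.card_univ, ← Finset.prod_const]
  refine Finset.prod_le_prod (fun _ _ => abs_nonneg _) fun j _ => (abs_add_le _ _).trans ?_
  rw [abs_one]
  exact add_le_add_right (abs_mul_le_of_abs_le_one hg θ (x j)) 1

theorem log_likelihood (hg : ∀ a, |g a| ≤ 1) (hθ : |θ| ≤ 1 / 2) (x : J → Ω) :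
    Real.log (likelihood g θ x) = ∑ j, Real.log (1 + θ * g (x j)) :=
  Real.log_prod fun j _ => (one_add_mul_pos hg hθ (x j)).ne'

theorem sum_eq_sqrt_card_mul_score (g : Ω → ℝ) (x : J → Ω) :
    ∑ j, g (x j) = √(Fintype.card J) * score g x := by
  rcases isEmpty_or_nonempty J with _ | _
  · simp
  · rw [score, mul_div_cancel₀]
    positivity

theorem log_likelihood_le (hg : ∀ a, |g a| ≤ 1) (hθ : |θ| ≤ 1 / 2) (x : J → Ω) :
    Real.log (likelihood g θ x) ≤ θ * √(Fintype.card J) * score g x := by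
  rw [log_likelihood hg hθ, mul_assoc, ← sum_eq_sqrt_card_mul_score, Finset.mul_sum]
  refine Finset.sum_le_sum fun j _ => ?_
  linarith [Real.log_le_sub_one_of_pos (one_add_mul_pos hg hθ (x j))]

theorem le_log_likelihood (hg : ∀ a, |g a| ≤ 1) (hθ : |θ| ≤ 1 / 2) (x : J → Ω) :
    θ * √(Fintype.card J) * score g x - 2 * θ ^ 2 * Fintype.card J ≤
      Real.log (likelihood g θ x) := by
  have hcard : 2 * θ ^ 2 * Fintype.card J = ∑ _j : J, 2 * θ ^ 2 := by simp [mul_comm]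
  rw [log_likelihood hg hθ, mul_assoc, ← sum_eq_sqrt_card_mul_score, Finset.mul_sum, hcard,
    ← Finset.sum_sub_distrib]
  refine Finset.sum_le_sum fun j _ => ?_
  have habs := abs_mul_le_of_abs_le_one hg θ (x j)
  have hlog := sub_two_mul_sq_le_log_one_add (x := θ * g (x j))
    (by linarith [(abs_le.1 (habs.trans hθ)).1])
  linarith [sq_le_sq.2 habs]

theorem abs_score_le (hg : ∀ a, |g a| ≤ 1) (x : J → Ω) : |score g x| ≤ √(Fintype.card J) := by
  rw [score, abs_div, abs_of_nonneg (Real.sqrt_nonneg _)]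
  refine div_le_of_le_mul₀ (by positivity) (by positivity) ?_
  rw [Real.mul_self_sqrt (by positivity)]
  calc |∑ j, g (x j)| ≤ ∑ j, |g (x j)| := Finset.abs_sum_le_sum_abs _ _
    _ ≤ ∑ _j : J, (1 : ℝ) := Finset.sum_le_sum fun j _ => hg _
    _ = Fintype.card J := by simp

theorem exp_mul_score_le_two_mul_likelihood (hg : ∀ a, |g a| ≤ 1) (hθ : |θ| ≤ 1 / 2)
    (hθ2 : 2 * θ ^ 2 * Fintype.card J ≤ 1 / 2) (x : J → Ω) :
    Real.exp (θ * √(Fintype.card J) * score g x) ≤ 2 * likelihood g θ x := by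
  have hpos := likelihood_pos hg hθ x
  have hlog := le_log_likelihood hg hθ x
  calc Real.exp (θ * √(Fintype.card J) * score g x)
      ≤ Real.exp (1 / 2 + Real.log (likelihood g θ x)) := by gcongr; linarith
    _ = Real.exp (1 / 2) * likelihood g θ x := by rw [Real.exp_add, Real.exp_log hpos]
    _ ≤ 2 * likelihood g θ x := by gcongr; exact exp_half_le_two

section Nonempty

variable [Nonempty J]

theorem one_le_sqrt_card : 1 ≤ √(Fintype.card J : ℝ) := by
  rw [Real.one_le_sqrt]
  exact_mod_cast Fintype.card_pos (α := J)

theorem abs_le_half_of_mul_sqrt_card_le (hθ0 : 0 ≤ θ) (hθ : θ * √(Fintype.card J) ≤ 1 / 2) :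
    |θ| ≤ 1 / 2 := by
  rw [abs_of_nonneg hθ0]
  exact (le_mul_of_one_le_right hθ0 one_le_sqrt_card).trans hθ

theorem abs_log_likelihood_le (hg : ∀ a, |g a| ≤ 1) (hθ0 : 0 ≤ θ)
    (hθ : θ * √(Fintype.card J) ≤ 1 / 2) (x : J → Ω) :
    |Real.log (likelihood g θ x)| ≤ θ * √(Fintype.card J) * (|score g x| + 1) := by
  have hθ' := abs_le_half_of_mul_sqrt_card_le hθ0 hθ
  have hu := log_likelihood_le hg hθ' x
  have hl := le_log_likelihood hg hθ' x
  have hsq : 2 * θ ^ 2 * Fintype.card J = 2 * (θ * √(Fintype.card J)) ^ 2 := by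
    rw [mul_pow, Real.sq_sqrt (by positivity)]; ring
  rw [hsq] at hl
  have hpos : 0 ≤ θ * √(Fintype.card J) := by positivity
  have hup := mul_le_mul_of_nonneg_left (le_abs_self (score g x)) hpos
  have hlow := mul_le_mul_of_nonneg_left (neg_abs_le (score g x)) hpos
  rw [abs_le]
  constructor <;> nlinarith

theorem exp_abs_score_le (hg : ∀ a, |g a| ≤ 1) (x : J → Ω) :
    Real.exp (|score g x| / 2) ≤ 2 * (likelihood g (1 / (2 * √(Fintype.card J))) x +
      likelihood g (-(1 / (2 * √(Fintype.card J)))) x) := by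
  have := one_le_sqrt_card (J := J)
  set a : ℝ := 1 / (2 * √(Fintype.card J)) with ha
  have haJ : a * √(Fintype.card J) = 1 / 2 := by rw [ha]; field_simp
  have ha0 : 0 ≤ a := by positivity
  have habs : |a| ≤ 1 / 2 := abs_le_half_of_mul_sqrt_card_le ha0 haJ.le
  have hsq : 2 * a ^ 2 * Fintype.card J ≤ 1 / 2 := by
    have : 2 * a ^ 2 * Fintype.card J = 2 * (a * √(Fintype.card J)) ^ 2 := by
      rw [mul_pow, Real.sq_sqrt (by positivity)]; ring
    rw [this, haJ]; norm_num
  have hplus := exp_mul_score_le_two_mul_likelihood hg habs hsq x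
  have hminus := exp_mul_score_le_two_mul_likelihood (θ := -a) hg (by rwa [abs_neg])
    (by rwa [neg_sq]) x
  have hposp := likelihood_pos hg habs x
  have hposm := likelihood_pos hg (θ := -a) (by rwa [abs_neg]) x
  rw [neg_mul, haJ] at hminus
  rw [haJ] at hplus
  rcases abs_choice (score g x) with h | h <;> rw [h]
  · rw [show score g x / 2 = 1 / 2 * score g x by ring]; linarith
  · rw [show -score g x / 2 = -(1 / 2) * score g x by ring]; linarith

end Nonempty

end Likelihood

section ProductMeasure

variable {Ω J : Type*} [MeasurableSpace Ω] [Fintype J] {g : Ω → ℝ} {θ : ℝ}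

theorem measurable_likelihood (hg : Measurable g) (θ : ℝ) :
    Measurable (likelihood g θ : (J → Ω) → ℝ) := by
  unfold likelihood
  fun_prop

theorem measurable_score (hg : Measurable g) : Measurable (score g : (J → Ω) → ℝ) := by
  unfold score
  fun_prop

theorem integrable_likelihood (hg : Measurable g) (hg1 : ∀ a, |g a| ≤ 1) (θ : ℝ)
    (Q : Measure (J → Ω)) [IsFiniteMeasure Q] : Integrable (likelihood g θ) Q :=
  Integrable.of_bound (measurable_likelihood hg θ).aestronglyMeasurable _
    (.of_forall fun x => abs_likelihood_le hg1 θ x)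

theorem lintegral_pi_prod_eq_prod {X : J → Type*} [∀ j, MeasurableSpace (X j)]
    (μ : ∀ j, Measure (X j)) [∀ j, IsProbabilityMeasure (μ j)] {f : ∀ j, X j → ENNReal}
    (hf : ∀ j, Measurable (f j)) :
    ∫⁻ x, ∏ j, f j (x j) ∂Measure.pi μ = ∏ j, ∫⁻ y, f j y ∂μ j := by
  refine (ProbabilityTheory.lintegral_prod_eq_prod_lintegral_of_indepFun Finset.univ
    (fun j (x : ∀ j, X j) => f j (x j))
    (ProbabilityTheory.iIndepFun_pi fun j => (hf j).aemeasurable)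
    fun j => (hf j).comp (measurable_pi_apply j)).trans ?_
  exact Finset.prod_congr rfl fun j _ => (measurePreserving_eval μ j).lintegral_comp (hf j)

theorem pi_withDensity {X : J → Type*} [∀ j, MeasurableSpace (X j)]
    (μ : ∀ j, Measure (X j)) [∀ j, IsProbabilityMeasure (μ j)] {f : ∀ j, X j → ENNReal}
    (hf : ∀ j, Measurable (f j)) [∀ j, SigmaFinite ((μ j).withDensity (f j))] :
    Measure.pi (fun j => (μ j).withDensity (f j)) =
      (Measure.pi μ).withDensity fun x => ∏ j, f j (x j) := by
  refine Measure.pi_eq fun s hs => ?_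
  rw [withDensity_apply _ (.univ_pi hs), ← lintegral_indicator (.univ_pi hs)]
  calc ∫⁻ x, (Set.univ.pi s).indicator (fun x => ∏ j, f j (x j)) x ∂Measure.pi μ
      = ∫⁻ x, ∏ j, (s j).indicator (f j) (x j) ∂Measure.pi μ := by
        congr with x
        classical
        simp only [Set.indicator_apply, Set.mem_univ_pi, Finset.prod_ite_zero, Finset.mem_univ,
          true_implies]
    _ = ∏ j, ∫⁻ y, (s j).indicator (f j) y ∂μ j :=
        lintegral_pi_prod_eq_prod μ fun j => (hf j).indicator (hs j)
    _ = ∏ j, (μ j).withDensity (f j) (s j) :=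
        Finset.prod_congr rfl fun j _ => by
          rw [lintegral_indicator (hs j), withDensity_apply _ (hs j)]

theorem pi_perturb (μ₀ : Measure Ω) [IsProbabilityMeasure μ₀] (hg : Measurable g)
    (hg1 : ∀ a, |g a| ≤ 1) (hθ : |θ| ≤ 1 / 2) :
    (Measure.pi fun _ : J => perturb μ₀ θ g) =
      (Measure.pi fun _ : J => μ₀).withDensity fun x => ENNReal.ofReal (likelihood g θ x) := by
  unfold perturb
  rw [pi_withDensity (fun _ => μ₀) fun _ => by fun_prop]
  congr with x
  exact (ENNReal.ofReal_prod_of_nonneg fun j _ => (one_add_mul_pos hg1 hθ (x j)).le).symm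

theorem integrable_exp_mul_score (hg : Measurable g) (hg1 : ∀ a, |g a| ≤ 1) (α : ℝ)
    (Q : Measure (J → Ω)) [IsFiniteMeasure Q] :
    Integrable (fun x => Real.exp (α * score g x)) Q := by
  refine ProbabilityTheory.integrable_exp_mul_of_mem_Icc (a := -√(Fintype.card J))
    (b := √(Fintype.card J)) (measurable_score hg).aemeasurable (.of_forall fun x => ?_)
  exact abs_le.1 (abs_score_le hg1 x)

theorem integral_exp_mul_score_le [Nonempty J] (μ₀ : Measure Ω) [IsProbabilityMeasure μ₀]
    (hg : Measurable g) (hg1 : ∀ a, |g a| ≤ 1) (h0 : ∫ a, g a ∂μ₀ = 0) (α : ℝ) :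
    ∫ x, Real.exp (α * score g x) ∂(Measure.pi fun _ : J => μ₀) ≤ Real.exp (α ^ 2 / 2) := by
  have hfactor : ∀ x : J → Ω,
      Real.exp (α * score g x) = ∏ j, Real.exp (α / √(Fintype.card J) * g (x j)) := by
    intro x
    rw [← Real.exp_sum, ← Finset.mul_sum, score]
    congr 1; ring
  have hmgf : ∀ s : ℝ, ∫ a, Real.exp (s * g a) ∂μ₀ ≤ Real.exp (s ^ 2 / 2) := by
    intro s
    have hHoeffding := (ProbabilityTheory.hasSubgaussianMGF_of_mem_Icc_of_integral_eq_zero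
      (μ := μ₀) (a := -1) (b := 1) hg.aemeasurable
      (.of_forall fun a => abs_le.1 (hg1 a)) h0).mgf_le s
    have hparam : ((‖(1 : ℝ) - -1‖₊ / 2) ^ 2 : NNReal) = 1 := by
      rw [show (1 : ℝ) - -1 = 2 by norm_num]
      ext; simp
    rwa [hparam, NNReal.coe_one, one_mul] at hHoeffding
  simp_rw [hfactor]
  rw [integral_fintype_prod_eq_pow (fun a => Real.exp (α / √(Fintype.card J) * g a))]
  calc (∫ a, Real.exp (α / √(Fintype.card J) * g a) ∂μ₀) ^ Fintype.card J
      ≤ Real.exp ((α / √(Fintype.card J)) ^ 2 / 2) ^ Fintype.card J := by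
        gcongr
        exact hmgf _
    _ = Real.exp (α ^ 2 / 2) := by
        rw [← Real.exp_nat_mul, div_pow, Real.sq_sqrt (by positivity)]
        congr 1
        field_simp

theorem integrable_exp_mul_abs_score (hg : Measurable g) (hg1 : ∀ a, |g a| ≤ 1) (α : ℝ)
    (Q : Measure (J → Ω)) [IsFiniteMeasure Q] :
    Integrable (fun x => Real.exp (α * |score g x|)) Q := by
  refine ProbabilityTheory.integrable_exp_mul_of_mem_Icc (a := 0) (b := √(Fintype.card J))
    (measurable_score hg).abs.aemeasurable (.of_forall fun x => ?_)
  exact ⟨abs_nonneg _, abs_score_le hg1 x⟩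

theorem integral_exp_mul_abs_score_le [Nonempty J] (μ₀ : Measure Ω) [IsProbabilityMeasure μ₀]
    (hg : Measurable g) (hg1 : ∀ a, |g a| ≤ 1) (h0 : ∫ a, g a ∂μ₀ = 0) (α : ℝ) :
    ∫ x, Real.exp (α * |score g x|) ∂(Measure.pi fun _ : J => μ₀) ≤
      2 * Real.exp (α ^ 2 / 2) := by
  have hplus := integral_exp_mul_score_le (J := J) μ₀ hg hg1 h0 α
  have hminus := integral_exp_mul_score_le (J := J) μ₀ hg hg1 h0 (-α)
  rw [neg_sq] at hminus
  have hi := fun β => integrable_exp_mul_score (J := J) hg hg1 β (Measure.pi fun _ => μ₀)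
  calc ∫ x, Real.exp (α * |score g x|) ∂(Measure.pi fun _ : J => μ₀)
      ≤ ∫ x, (Real.exp (α * score g x) + Real.exp (-α * score g x))
        ∂(Measure.pi fun _ : J => μ₀) := by
        refine integral_mono (integrable_exp_mul_abs_score hg hg1 α _) ((hi α).add (hi (-α))) ?_
        intro x
        dsimp only
        rcases abs_choice (score g x) with h | h <;> rw [h]
        · linarith [Real.exp_pos (-α * score g x)]
        · rw [mul_neg, ← neg_mul]
          linarith [Real.exp_pos (α * score g x)]
    _ = _ := integral_add (hi α) (hi (-α))
    _ ≤ _ := by linarith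

end ProductMeasure

/-! ### Mixed moments of multiaffine statistics -/

/-- Transposition of a relation between `α` and `β`, given by its rows, into its columns. -/
def finsetTranspose (α β : Type*) [Fintype α] [Fintype β] [DecidableEq α] [DecidableEq β] :
    (α → Finset β) ≃ (β → Finset α) where
  toFun p b := Finset.univ.filter fun a => b ∈ p a
  invFun q a := Finset.univ.filter fun b => a ∈ q b
  left_inv p := by ext a b; simp
  right_inv q := by ext b a; simp

theorem prod_prod_mem_transpose {α β M : Type*} [Fintype α] [Fintype β] [DecidableEq α]
    [DecidableEq β] [CommMonoid M] (p : α → Finset β) (f : α → β → M) :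
    ∏ a, ∏ b ∈ p a, f a b = ∏ b, ∏ a ∈ finsetTranspose α β p b, f a b :=
  Finset.prod_comm' (by simp [finsetTranspose])

section Multiaffine

variable {Ω I J : Type*} [MeasurableSpace Ω] [Fintype J] {μ₀ : Measure Ω}
  [IsProbabilityMeasure μ₀] {g : I → Ω → ℝ}

theorem integrable_prod_prod (hg : ∀ i, Measurable (g i)) (hg1 : ∀ i a, |g i a| ≤ 1)
    (q : J → Finset I) :
    Integrable (fun x : J → Ω => ∏ j, ∏ i ∈ q j, g i (x j)) (Measure.pi fun _ => μ₀) := by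
  refine Integrable.of_bound (C := 1) ?_ (.of_forall fun x => ?_)
  · exact (by fun_prop : Measurable _).aestronglyMeasurable
  · rw [Real.norm_eq_abs, Finset.abs_prod]
    refine Finset.prod_le_one (fun _ _ => abs_nonneg _) fun j _ => ?_
    rw [Finset.abs_prod]
    exact Finset.prod_le_one (fun _ _ => abs_nonneg _) fun i _ => hg1 i (x j)

variable [Fintype I]

theorem prod_multiaffine_eq_sum [DecidableEq I] [DecidableEq J] (A : I → Finset J → ℝ)
    (f : I → J → ℝ) :
    ∏ i, ∑ S, A i S * ∏ j ∈ S, f i j =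
      ∑ p : I → Finset J, (∏ i, A i (p i)) * ∏ j, ∏ i ∈ finsetTranspose I J p j, f i j := by
  rw [Finset.prod_univ_sum, Fintype.piFinset_univ]
  refine Finset.sum_congr rfl fun p _ => ?_
  rw [Finset.prod_mul_distrib, prod_prod_mem_transpose]

theorem integrable_prod_multiaffine (hg : ∀ i, Measurable (g i)) (hg1 : ∀ i a, |g i a| ≤ 1)
    (A : I → Finset J → ℝ) :
    Integrable (fun x : J → Ω => ∏ i, ∑ S, A i S * ∏ j ∈ S, g i (x j))
      (Measure.pi fun _ => μ₀) := by
  classical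
  simp_rw [fun x : J → Ω => prod_multiaffine_eq_sum A fun i j => g i (x j)]
  exact integrable_finsetSum _ fun p _ => (integrable_prod_prod hg hg1 _).const_mul _

/-- Exchanging the roles of family members and samples turns the expectation of a product of
multiaffine statistics into a `|J|`-fold product of mixed moments of a single sample. -/
theorem integral_prod_multiaffine_le (hg : ∀ i, Measurable (g i)) (hg1 : ∀ i a, |g i a| ≤ 1)
    {a : ℝ} {A : I → Finset J → ℝ} {b : I → ℝ} (hA : ∀ i S, |A i S| ≤ b i * a ^ S.card) :
    ∫ x, ∏ i, ∑ S, A i S * ∏ j ∈ S, g i (x j) ∂(Measure.pi fun _ : J => μ₀) ≤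
      (∏ i, b i) *
        (∑ T : Finset I, a ^ T.card * |∫ y, ∏ i ∈ T, g i y ∂μ₀|) ^ Fintype.card J := by
  classical
  let c : Finset I → ℝ := fun T => ∫ y, ∏ i ∈ T, g i y ∂μ₀
  have hterm : ∀ p : I → Finset J, ∫ x : J → Ω, (∏ i, A i (p i)) *
        ∏ j, ∏ i ∈ finsetTranspose I J p j, g i (x j) ∂(Measure.pi fun _ => μ₀) ≤
      (∏ i, b i) *
        ∏ j, (a ^ (finsetTranspose I J p j).card * |c (finsetTranspose I J p j)|) := by
    intro p
    have hcoeff : ∏ i, |A i (p i)| ≤ (∏ i, b i) * ∏ j, a ^ (finsetTranspose I J p j).card := calc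
      ∏ i, |A i (p i)| ≤ ∏ i, (b i * a ^ (p i).card) :=
        Finset.prod_le_prod (fun _ _ => abs_nonneg _) fun i _ => hA i _
      _ = (∏ i, b i) * ∏ j, a ^ (finsetTranspose I J p j).card := by
        simp_rw [Finset.prod_mul_distrib, ← Finset.prod_const]
        rw [prod_prod_mem_transpose p fun _ _ => a]
    rw [integral_const_mul, integral_fintype_prod_eq_prod
      (fun j y => ∏ i ∈ finsetTranspose I J p j, g i y)]
    refine (le_abs_self _).trans ?_
    rw [abs_mul, Finset.abs_prod, Finset.abs_prod, Finset.prod_mul_distrib, ← mul_assoc]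
    exact mul_le_mul_of_nonneg_right hcoeff (Finset.prod_nonneg fun _ _ => abs_nonneg _)
  simp_rw [fun x : J → Ω => prod_multiaffine_eq_sum A fun i j => g i (x j)]
  rw [integral_finsetSum _ fun p _ => (integrable_prod_prod hg hg1 _).const_mul _]
  refine (Finset.sum_le_sum fun p _ => hterm p).trans_eq ?_
  rw [← Finset.mul_sum, (finsetTranspose I J).sum_comp
    (fun q => ∏ j, (a ^ (q j).card * |c (q j)|)), ← Finset.card_univ, ← Finset.prod_const,
    Finset.prod_univ_sum, Fintype.piFinset_univ]

end Multiaffine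

/-! ### Nearly independent families -/

/-- A family of centered functions bounded by `1` whose mixed moments under `μ₀`, at the scale
`n^{-1/2}` natural for `n` samples, sum to at most `1 + 1 / n`; the empty product accounts for
the term `1`. Over `n` samples the total weight of all moments is then bounded by
`(1 + 1 / n) ^ n ≤ e`. -/
structure IsNearlyIndependent {Ω I : Type*} [MeasurableSpace Ω] [Fintype I] (μ₀ : Measure Ω)
    (g : I → Ω → ℝ) (n : ℕ) : Prop where
  measurable : ∀ i, Measurable (g i)
  abs_le_one : ∀ i a, |g i a| ≤ 1
  integral_eq_zero : ∀ i, ∫ a, g i a ∂μ₀ = 0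
  sum_le : ∑ S : Finset I, (1 / √(n : ℝ)) ^ S.card * |∫ a, ∏ i ∈ S, g i a ∂μ₀| ≤
    1 + 1 / (n : ℝ)

/-- The multiaffine statistic used to dominate `exp (u (likelihood g ρ x - 1) / (ρ √|J|))`: its
linearization, plus `κ` times an upper bound for `exp (|score g x| / 2) / 2`. -/
noncomputable def tiltFactor {Ω J : Type*} [Fintype J] (g : Ω → ℝ) (ρ u κ : ℝ) (x : J → Ω) : ℝ :=
  1 + u / (ρ * √(Fintype.card J)) * (likelihood g ρ x - 1) +
    κ * (likelihood g (1 / (2 * √(Fintype.card J))) x +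
      likelihood g (-(1 / (2 * √(Fintype.card J)))) x)

/-- The coefficient of the monomials of degree `m` in `tiltFactor`, for samples indexed by
`J`. -/
noncomputable def tiltCoeff (J : Type*) [Fintype J] (ρ u κ : ℝ) (m : ℕ) : ℝ :=
  (if m = 0 then 1 else u / (ρ * √(Fintype.card J)) * ρ ^ m) +
    κ * ((1 / (2 * √(Fintype.card J))) ^ m + (-(1 / (2 * √(Fintype.card J)))) ^ m)

section Tilt

variable {Ω J : Type*} [Fintype J]

theorem likelihood_eq_sum (g : Ω → ℝ) (θ : ℝ) (x : J → Ω) :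
    likelihood g θ x = ∑ S : Finset J, θ ^ S.card * ∏ j ∈ S, g (x j) := by
  classical
  rw [likelihood, Finset.prod_one_add, Finset.powerset_univ]
  simp_rw [Finset.prod_mul_distrib, Finset.prod_const]

theorem one_add_mul_likelihood_sub_one (g : Ω → ℝ) (c θ : ℝ) (x : J → Ω) :
    1 + c * (likelihood g θ x - 1) =
      ∑ S : Finset J, (if S.card = 0 then 1 else c * θ ^ S.card) * ∏ j ∈ S, g (x j) := by
  classical
  have hsplit : ∀ S : Finset J, (if S.card = 0 then 1 else c * θ ^ S.card) * ∏ j ∈ S, g (x j) =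
      c * (θ ^ S.card * ∏ j ∈ S, g (x j)) + if S = ∅ then 1 - c else 0 := by
    intro S
    rcases eq_or_ne S ∅ with rfl | hS
    · simp
    · rw [if_neg (Finset.card_ne_zero.2 (Finset.nonempty_iff_ne_empty.2 hS)), if_neg hS]
      ring
  simp_rw [hsplit]
  rw [Finset.sum_add_distrib, ← Finset.mul_sum, ← likelihood_eq_sum, Fintype.sum_ite_eq']
  ring

theorem tiltFactor_eq_sum (g : Ω → ℝ) (ρ u κ : ℝ) (x : J → Ω) :
    tiltFactor g ρ u κ x =
      ∑ S : Finset J, tiltCoeff J ρ u κ S.card * ∏ j ∈ S, g (x j) := by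
  rw [tiltFactor, one_add_mul_likelihood_sub_one]
  simp only [tiltCoeff, likelihood_eq_sum, add_mul, Finset.sum_add_distrib, Finset.mul_sum,
    mul_add, mul_assoc]

theorem abs_tiltCoeff_le [Nonempty J] {ρ u κ : ℝ} (hρ : 0 < ρ)
    (hρJ : ρ * √(Fintype.card J) ≤ 1) (hu : |u| ≤ 1) (hκ : 0 ≤ κ) (m : ℕ) :
    |tiltCoeff J ρ u κ m| ≤ (1 + 2 * κ) * (1 / √(Fintype.card J)) ^ m := by
  have hs : 1 ≤ √(Fintype.card J : ℝ) := one_le_sqrt_card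
  set s : ℝ := √(Fintype.card J)
  have hlinear : |if m = 0 then 1 else u / (ρ * s) * ρ ^ m| ≤ (1 / s) ^ m := by
    rcases m with _ | m
    · simp
    · have : u / (ρ * s) * ρ ^ (m + 1) = u * (ρ * s) ^ m * (1 / s) ^ (m + 1) := by
        rw [mul_pow, one_div, inv_pow, pow_succ, pow_succ]
        field_simp
      rw [if_neg m.succ_ne_zero, this, abs_mul, abs_mul,
        abs_of_pos (by positivity : 0 < (ρ * s) ^ m),
        abs_of_pos (by positivity : 0 < (1 / s) ^ (m + 1))]
      exact mul_le_of_le_one_left (by positivity)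
        (mul_le_one₀ hu (by positivity) (pow_le_one₀ (by positivity) hρJ))
  have hpow : ∀ θ : ℝ, |θ| = 1 / (2 * s) → |θ ^ m| ≤ (1 / s) ^ m := by
    intro θ hθ
    rw [abs_pow, hθ]
    gcongr
    linarith
  have hhalf : |1 / (2 * s)| = 1 / (2 * s) := abs_of_pos (by positivity)
  calc |tiltCoeff J ρ u κ m| ≤ (1 / s) ^ m + κ * ((1 / s) ^ m + (1 / s) ^ m) := by
        refine (abs_add_le _ _).trans (add_le_add hlinear ?_)
        rw [abs_mul, abs_of_nonneg hκ]
        gcongr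
        exact (abs_add_le _ _).trans
          (add_le_add (hpow _ hhalf) (hpow _ (by rw [abs_neg, hhalf])))
    _ = (1 + 2 * κ) * (1 / s) ^ m := by ring

variable {I : Type*} [Fintype I] [MeasurableSpace Ω] {μ₀ : Measure Ω} [IsProbabilityMeasure μ₀]
  {g : I → Ω → ℝ}

theorem integrable_prod_tiltFactor (hg : ∀ i, Measurable (g i)) (hg1 : ∀ i a, |g i a| ≤ 1)
    (ρ : ℝ) (u κ : I → ℝ) :
    Integrable (fun x : J → Ω => ∏ i, tiltFactor (g i) ρ (u i) (κ i) x)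
      (Measure.pi fun _ => μ₀) := by
  simp_rw [tiltFactor_eq_sum]
  exact integrable_prod_multiaffine hg hg1 _

theorem integral_prod_tiltFactor_le [Nonempty J]
    (h : IsNearlyIndependent μ₀ g (Fintype.card J)) {ρ : ℝ} (hρ : 0 < ρ)
    (hρJ : ρ * √(Fintype.card J) ≤ 1) {u κ : I → ℝ} (hu : ∀ i, |u i| ≤ 1) (hκ : ∀ i, 0 ≤ κ i) :
    ∫ x, ∏ i, tiltFactor (g i) ρ (u i) (κ i) x ∂(Measure.pi fun _ : J => μ₀) ≤
      Real.exp (1 + 2 * ∑ i, κ i) := by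
  simp_rw [tiltFactor_eq_sum]
  refine (integral_prod_multiaffine_le h.measurable h.abs_le_one
    fun i S => abs_tiltCoeff_le hρ hρJ (hu i) (hκ i) S.card).trans ?_
  have hcoeff : ∏ i, (1 + 2 * κ i) ≤ Real.exp (2 * ∑ i, κ i) := by
    rw [Finset.mul_sum, Real.exp_sum]
    refine Finset.prod_le_prod (fun i _ => by have := hκ i; positivity) fun i _ => ?_
    rw [add_comm]
    exact Real.add_one_le_exp _
  have hmoments : (1 + 1 / (Fintype.card J : ℝ)) ^ Fintype.card J ≤ Real.exp 1 := calc
    _ ≤ Real.exp (1 / (Fintype.card J : ℝ)) ^ Fintype.card J := by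
      gcongr
      rw [add_comm]
      exact Real.add_one_le_exp _
    _ = Real.exp 1 := by
      rw [← Real.exp_nat_mul]
      congr 1
      field_simp
  rw [add_comm, Real.exp_add]
  gcongr
  refine le_trans ?_ hmoments
  gcongr
  exact h.sum_le

end Tilt

/-! ### Deviation of a likelihood ratio under a change of measure -/

/-- The contribution to `L - 1 - log L` of the values of `L` outside `[1/2, 2]`. -/
noncomputable def farTail (L : ℝ) : ℝ := max (-Real.log (2 * L)) 0 + max (L - 2) 0

/-- The statistic whose mean under `Q` measures how far the mean of `L` is from `1`; upward
deviations are truncated, which makes its exponential moments available. -/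
noncomputable def truncTest {Y : Type*} [MeasurableSpace Y] (Q : Measure Y) (L : Y → ℝ) (x : Y) :
    ℝ :=
  if ∫ y, L y ∂Q < 1 then 1 - L x else min (L x - 1) 1

/-- The direction in which `truncTest Q L` depends on `L`. -/
noncomputable def truncSign {Y : Type*} [MeasurableSpace Y] (Q : Measure Y) (L : Y → ℝ) : ℝ :=
  if ∫ y, L y ∂Q < 1 then -1 else 1

/-- The deviation from `1` of the mean of `L` under `Q`, where upward deviations are
truncated. -/
noncomputable def truncDev {Y : Type*} [MeasurableSpace Y] (Q : Measure Y) (L : Y → ℝ) : ℝ :=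
  max (∫ x, truncTest Q L x ∂Q) 0

theorem farTail_nonneg (L : ℝ) : 0 ≤ farTail L :=
  add_nonneg (le_max_right _ _) (le_max_right _ _)

theorem neg_log_two_mul_le_farTail (L : ℝ) : -Real.log (2 * L) ≤ farTail L :=
  (le_max_left _ _).trans (le_add_of_nonneg_right (le_max_right _ _))

theorem sub_one_le_min_add_farTail (L : ℝ) : L - 1 ≤ min (L - 1) 1 + farTail L := by
  have hfar : max (L - 2) 0 ≤ farTail L := le_add_of_nonneg_left (le_max_right _ _)
  rcases le_total (L - 1) 1 with h | h
  · rw [min_eq_left h]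
    linarith [farTail_nonneg L]
  · rw [min_eq_right h]
    linarith [le_max_left (L - 2) 0]

theorem truncDev_nonneg {Y : Type*} [MeasurableSpace Y] (Q : Measure Y) (L : Y → ℝ) :
    0 ≤ truncDev Q L :=
  le_max_right _ _

theorem abs_truncSign {Y : Type*} [MeasurableSpace Y] (Q : Measure Y) (L : Y → ℝ) :
    |truncSign Q L| = 1 := by
  unfold truncSign
  split_ifs <;> simp

section Deviation

variable {Y : Type*} [MeasurableSpace Y] {Q : Measure Y} {L w : Y → ℝ}

theorem integrable_truncTest [IsFiniteMeasure Q] (hL : Integrable L Q) :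
    Integrable (truncTest Q L) Q := by
  unfold truncTest
  split_ifs
  · exact (integrable_const _).sub hL
  · exact (hL.sub (integrable_const _)).inf (integrable_const _)

theorem integrable_farTail [IsFiniteMeasure Q] (hpos : ∀ x, 0 < L x) (hL : Integrable L Q)
    (hlog : Integrable (fun x => Real.log (L x)) Q) :
    Integrable (fun x => farTail (L x)) Q := by
  simp_rw [farTail, fun x => Real.log_mul two_ne_zero (hpos x).ne']
  exact ((integrable_const _).add hlog).neg.pos_part.add (hL.sub (integrable_const _)).pos_part

variable [IsProbabilityMeasure Q]

theorem truncDev_of_integral_lt_one (hL : Integrable L Q) (h : ∫ x, L x ∂Q < 1) :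
    truncDev Q L = 1 - ∫ x, L x ∂Q := by
  have hmean : ∫ x, (1 - L x) ∂Q = 1 - ∫ x, L x ∂Q := by
    rw [integral_sub (integrable_const _) hL]
    simp
  simp_rw [truncDev, truncTest, if_pos h]
  rw [hmean, max_eq_left (by linarith)]

theorem neg_log_two_mul_integral_le (hpos : ∀ x, 0 < L x) (hL : Integrable L Q)
    (hlog : Integrable (fun x => Real.log (L x)) Q) (hr : 0 < ∫ x, L x ∂Q) :
    -Real.log (2 * ∫ x, L x ∂Q) ≤ ∫ x, farTail (L x) ∂Q := by
  set r := ∫ x, L x ∂Q with hrdef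
  have htangent : ∀ x, -Real.log (2 * r) + 1 - L x / r ≤ farTail (L x) := fun x => by
    have hle := Real.log_le_sub_one_of_pos (div_pos (hpos x) hr)
    have hfar := neg_log_two_mul_le_farTail (L x)
    rw [Real.log_div (hpos x).ne' hr.ne'] at hle
    rw [Real.log_mul two_ne_zero (hpos x).ne'] at hfar
    rw [Real.log_mul two_ne_zero hr.ne']
    linarith
  calc -Real.log (2 * r) = ∫ x, (-Real.log (2 * r) + 1 - L x / r) ∂Q := by
        rw [integral_sub (integrable_const _) (hL.div_const _), integral_div, ← hrdef,
          div_self hr.ne']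
        simp
    _ ≤ ∫ x, farTail (L x) ∂Q :=
        integral_mono ((integrable_const _).sub (hL.div_const _))
          (integrable_farTail hpos hL hlog) htangent

theorem integral_sub_one_le_truncDev_add (hpos : ∀ x, 0 < L x) (hL : Integrable L Q)
    (hlog : Integrable (fun x => Real.log (L x)) Q) (h : 1 ≤ ∫ x, L x ∂Q) :
    ∫ x, L x ∂Q - 1 ≤ truncDev Q L + ∫ x, farTail (L x) ∂Q := by
  have htest : ∀ x, L x - 1 ≤ truncTest Q L x + farTail (L x) := fun x => by
    rw [truncTest, if_neg h.not_gt]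
    exact sub_one_le_min_add_farTail (L x)
  have hint := integrable_truncTest hL
  have hfar := integrable_farTail hpos hL hlog
  calc ∫ x, L x ∂Q - 1 = ∫ x, (L x - 1) ∂Q := by
        rw [integral_sub hL (integrable_const _)]
        simp
    _ ≤ ∫ x, (truncTest Q L x + farTail (L x)) ∂Q :=
        integral_mono (hL.sub (integrable_const _)) (hint.add hfar) htest
    _ = ∫ x, truncTest Q L x ∂Q + ∫ x, farTail (L x) ∂Q := integral_add hint hfar
    _ ≤ truncDev Q L + ∫ x, farTail (L x) ∂Q := by gcongr; exact le_max_left _ _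

theorem sub_one_sub_log_integral_le (hpos : ∀ x, 0 < L x) (hL : Integrable L Q)
    (hlog : Integrable (fun x => Real.log (L x)) Q) (hr : 0 < ∫ x, L x ∂Q) :
    ∫ x, L x ∂Q - 1 - Real.log (∫ x, L x ∂Q) ≤
      2 * truncDev Q L ^ 2 + ∫ x, farTail (L x) ∂Q := by
  have hfar : 0 ≤ ∫ x, farTail (L x) ∂Q := integral_nonneg fun x => farTail_nonneg _
  rcases lt_or_ge (∫ x, L x ∂Q) 1 with hlt | hge
  · rw [truncDev_of_integral_lt_one hL hlt]
    have hlow := neg_log_two_mul_integral_le hpos hL hlog hr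
    set r := ∫ x, L x ∂Q
    rcases le_total (-(1 / 2)) (r - 1) with hhalf | hhalf
    · have := sub_two_mul_sq_le_log_one_add hhalf
      rw [add_sub_cancel] at this
      linarith [sub_sq_comm 1 r]
    · rw [Real.log_mul two_ne_zero hr.ne'] at hlow
      nlinarith [Real.log_two_lt_d9]
  · have hup := integral_sub_one_le_truncDev_add hpos hL hlog hge
    have hdev := truncDev_nonneg Q L
    set d := truncDev Q L
    set r := ∫ x, L x ∂Q
    rcases le_total (1 + d) r with hle | hle
    · have hmono : Real.log (1 + d) ≤ Real.log r := Real.log_le_log (by linarith) hle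
      linarith [sub_two_mul_sq_le_log_one_add (x := d) (by linarith)]
    · have := Real.one_sub_inv_le_log_of_pos hr
      have hquot : r - 1 - (1 - r⁻¹) = (r - 1) ^ 2 / r := by field_simp
      have hdiv : (r - 1) ^ 2 / r ≤ (r - 1) ^ 2 := div_le_self (sq_nonneg _) hge
      nlinarith

theorem truncDev_le {ε : ℝ} (hpos : ∀ x, 0 < L x) (hL : Integrable L Q)
    (hw : Integrable w Q) (hlog : ∀ x, |Real.log (L x)| ≤ ε * w x) :
    truncDev Q L ≤ 2 * ε * ∫ x, w x ∂Q := by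
  have hεw : ∀ x, 0 ≤ ε * w x := fun x => (abs_nonneg _).trans (hlog x)
  have hpt : ∀ x, truncTest Q L x ≤ 2 * ε * w x := fun x => by
    unfold truncTest
    split_ifs
    · linarith [neg_le_sub_one_of_abs_log_le (hpos x) (hlog x), hεw x]
    · linarith [le_of_abs_le (abs_min_sub_one_le (hpos x) (hlog x))]
  rw [← integral_const_mul]
  refine max_le (integral_mono (integrable_truncTest hL) (hw.const_mul _) hpt) ?_
  exact integral_nonneg fun x => by rw [mul_assoc]; exact mul_nonneg zero_le_two (hεw x)

/-- A quantity dominated by twice the mean of `w` is either at most `b`, or controlled by the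
values of `w` above `b / 4`. -/
theorem sq_le_mul_min_add_integral {X b : ℝ} (hX0 : 0 ≤ X) (hX : X ≤ 2 * ∫ x, w x ∂Q)
    (hb : 1 ≤ b) (hw : Integrable w Q)
    (hw2 : Integrable (fun x => max (w x - b / 4) 0 ^ 2) Q) :
    X ^ 2 ≤ b * (min X 1 * X) + 16 * ∫ x, max (w x - b / 4) 0 ^ 2 ∂Q := by
  have hint : 0 ≤ ∫ x, max (w x - b / 4) 0 ^ 2 ∂Q := integral_nonneg fun _ => sq_nonneg _
  rcases le_total X b with h | h
  · have : X ≤ b * min X 1 := by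
      rcases le_total X 1 with h1 | h1
      · rw [min_eq_left h1]
        exact le_mul_of_one_le_left hX0 hb
      · rwa [min_eq_right h1, mul_one]
    nlinarith
  · have hexcess : Integrable (fun x => max (w x - b / 4) 0) Q :=
      (hw.sub (integrable_const _)).pos_part
    have hmean : ∫ x, w x ∂Q - b / 4 ≤ ∫ x, max (w x - b / 4) 0 ∂Q := calc
      ∫ x, w x ∂Q - b / 4 = ∫ x, (w x - b / 4) ∂Q := by
        rw [integral_sub hw (integrable_const _)]
        simp
      _ ≤ _ := integral_mono (hw.sub (integrable_const _)) hexcess fun x => le_max_left _ _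
    have hjensen : (∫ x, max (w x - b / 4) 0 ∂Q) ^ 2 ≤ ∫ x, max (w x - b / 4) 0 ^ 2 ∂Q :=
      even_two.convexOn_pow.map_integral_le (by fun_prop) isClosed_univ
        (.of_forall fun _ => Set.mem_univ _) hexcess hw2
    have : X ≤ 4 * ∫ x, max (w x - b / 4) 0 ∂Q := by linarith
    have : 0 ≤ b * (min X 1 * X) := by positivity
    nlinarith

theorem integral_le_of_exp_le {P : Measure Y} {p B : ℝ} {U F : Y → ℝ} (hp : 0 < p)
    (hQ : Q ≤ ENNReal.ofReal p⁻¹ • P) (hU : Integrable U Q) (hF : Integrable F P)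
    (hUF : ∀ x, Real.exp (U x) ≤ F x) (hB : ∫ x, F x ∂P ≤ Real.exp B) :
    ∫ x, U x ∂Q ≤ Real.log p⁻¹ + B := by
  have hFsmul : Integrable F (ENNReal.ofReal p⁻¹ • P) := hF.smul_measure ENNReal.ofReal_ne_top
  have hFQ : Integrable F Q := hFsmul.mono_measure hQ
  have hF0 : ∀ x, 0 ≤ F x := fun x => (Real.exp_pos _).le.trans (hUF x)
  have hexp : Integrable (fun x => Real.exp (U x)) Q :=
    hFQ.mono' (Real.continuous_exp.comp_aestronglyMeasurable hU.aestronglyMeasurable)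
      (.of_forall fun x => by rw [Real.norm_eq_abs, Real.abs_exp]; exact hUF x)
  refine Real.exp_le_exp.1 ?_
  calc Real.exp (∫ x, U x ∂Q) ≤ ∫ x, Real.exp (U x) ∂Q :=
        convexOn_exp.map_integral_le Real.continuous_exp.continuousOn isClosed_univ
          (.of_forall fun _ => Set.mem_univ _) hU hexp
    _ ≤ ∫ x, F x ∂Q := integral_mono hexp hFQ hUF
    _ ≤ ∫ x, F x ∂(ENNReal.ofReal p⁻¹ • P) := integral_mono_measure hQ (.of_forall hF0) hFsmul
    _ = p⁻¹ * ∫ x, F x ∂P := by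
        rw [integral_smul_measure, ENNReal.toReal_ofReal (by positivity), smul_eq_mul]
    _ ≤ Real.exp (Real.log p⁻¹ + B) := by
        rw [Real.exp_add, Real.exp_log (by positivity)]
        gcongr

end Deviation

section Tilt

variable {Ω J : Type*} [Fintype J] {ρ : ℝ}

theorem exp_mul_truncTest_le_tiltFactor [Nonempty J] [MeasurableSpace Ω] {g : Ω → ℝ}
    (hg : ∀ a, |g a| ≤ 1) (hρ : 0 < ρ) (hρJ : ρ * √(Fintype.card J) ≤ 1 / 16)
    (Q : Measure (J → Ω)) {l : ℝ} (hl0 : 0 ≤ l) (hl : l ≤ 1 / 16) (x : J → Ω) :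
    Real.exp (l / (ρ * √(Fintype.card J)) * truncTest Q (likelihood g ρ) x) ≤
      tiltFactor g ρ (l * truncSign Q (likelihood g ρ)) (2048 * l ^ 2) x := by
  have hρJ' : ρ * √(Fintype.card J) ≤ 1 / 2 := hρJ.trans (by norm_num)
  have hpos := likelihood_pos hg (abs_le_half_of_mul_sqrt_card_le hρ.le hρJ') x
  have hlog := abs_log_likelihood_le hg hρ.le hρJ' x
  have hε : 0 < ρ * √(Fintype.card J) := by positivity
  have hw : 0 ≤ |score g x| + 1 := by positivity
  have hrem : 512 * l ^ 2 * Real.exp ((|score g x| + 1) / 2) ≤ 2048 * l ^ 2 *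
      (likelihood g (1 / (2 * √(Fintype.card J))) x +
        likelihood g (-(1 / (2 * √(Fintype.card J)))) x) := calc
    _ = 512 * l ^ 2 * (Real.exp (|score g x| / 2) * Real.exp (1 / 2)) := by
      rw [← Real.exp_add, add_div]
    _ ≤ 512 * l ^ 2 * (2 * (likelihood g (1 / (2 * √(Fintype.card J))) x +
        likelihood g (-(1 / (2 * √(Fintype.card J)))) x) * 2) := by
      have hscore := exp_abs_score_le hg x
      exact mul_le_mul_of_nonneg_left (mul_le_mul hscore exp_half_le_two (Real.exp_nonneg _)
        ((Real.exp_nonneg _).trans hscore)) (by positivity)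
    _ = _ := by ring
  unfold tiltFactor truncTest truncSign
  split_ifs
  · refine (exp_neg_mul_sub_one_le hpos hε hρJ hl0 hl hw hlog).trans
      (add_le_add (le_of_eq ?_) hrem)
    ring
  · rw [mul_one]
    exact (exp_mul_min_sub_one_le hpos hε hl0 hl hw hlog).trans (add_le_add le_rfl hrem)

variable [Nonempty J] [MeasurableSpace Ω] {I : Type*} [Fintype I] {μ₀ : Measure Ω}
  [IsProbabilityMeasure μ₀] {g : I → Ω → ℝ}

theorem sum_mul_integral_truncTest_le (h : IsNearlyIndependent μ₀ g (Fintype.card J))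
    (hρ : 0 < ρ) (hρJ : ρ * √(Fintype.card J) ≤ 1 / 16) (Q : Measure (J → Ω))
    [IsProbabilityMeasure Q] {p : ℝ} (hp : 0 < p)
    (hQ : Q ≤ ENNReal.ofReal p⁻¹ • Measure.pi fun _ => μ₀) {l : I → ℝ} (hl0 : ∀ i, 0 ≤ l i)
    (hl : ∀ i, l i ≤ 1 / 16) :
    ∑ i, l i / (ρ * √(Fintype.card J)) * ∫ x, truncTest Q (likelihood (g i) ρ) x ∂Q ≤
      Real.log p⁻¹ + (1 + 4096 * ∑ i, l i ^ 2) := by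
  set L : I → (J → Ω) → ℝ := fun i => likelihood (g i) ρ
  have hU : ∀ i, Integrable (fun x => l i / (ρ * √(Fintype.card J)) * truncTest Q (L i) x) Q :=
    fun i => (integrable_truncTest
      (integrable_likelihood (h.measurable i) (h.abs_le_one i) ρ Q)).const_mul _
  have hexp : ∀ x, Real.exp (∑ i, l i / (ρ * √(Fintype.card J)) * truncTest Q (L i) x) ≤
      ∏ i, tiltFactor (g i) ρ (l i * truncSign Q (L i)) (2048 * l i ^ 2) x := fun x => by
    rw [Real.exp_sum]
    exact Finset.prod_le_prod (fun _ _ => Real.exp_nonneg _) fun i _ =>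
      exp_mul_truncTest_le_tiltFactor (h.abs_le_one i) hρ hρJ Q (hl0 i) (hl i) x
  have hsign : ∀ i, |l i * truncSign Q (L i)| ≤ 1 := fun i => by
    rw [abs_mul, abs_truncSign, mul_one, abs_of_nonneg (hl0 i)]
    linarith [hl i]
  have hprod := integral_prod_tiltFactor_le h hρ (hρJ.trans (by norm_num)) hsign
    (κ := fun i => 2048 * l i ^ 2) fun i => by positivity
  rw [← Finset.mul_sum, ← mul_assoc, show (2 : ℝ) * 2048 = 4096 by norm_num] at hprod
  have hmain := integral_le_of_exp_le hp hQ (integrable_finsetSum _ fun i _ => hU i)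
    (integrable_prod_tiltFactor h.measurable h.abs_le_one ρ _ _) hexp hprod
  rw [integral_finsetSum _ fun i _ => hU i] at hmain
  simpa only [integral_const_mul] using hmain

end Tilt

/-! ### Atypical samples -/

/-- The contribution of an atypical sample `x` to the information it carries about `g`: extreme
values of the likelihood ratio, and values of the score beyond the threshold `b`. -/
noncomputable def tail {Ω J : Type*} [Fintype J] (g : Ω → ℝ) (ρ b : ℝ) (x : J → Ω) : ℝ :=
  farTail (likelihood g ρ x) +
    32 * (ρ * √(Fintype.card J)) ^ 2 * max (|score g x| + 1 - b) 0 ^ 2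

theorem farTail_eq_zero {L : ℝ} (h : 1 / 2 ≤ L) (h' : L ≤ 2) : farTail L = 0 := by
  rw [farTail, max_eq_right, max_eq_right, add_zero]
  · linarith
  · linarith [Real.log_nonneg (x := 2 * L) (by linarith)]

theorem farTail_le_exp_abs_log {L : ℝ} (hL : 0 < L) : farTail L ≤ Real.exp |Real.log L| := by
  rcases le_total L 1 with h | h
  · rw [farTail, max_eq_right (by linarith : L - 2 ≤ 0), add_zero,
      Real.log_mul two_ne_zero hL.ne']
    refine max_le ?_ (Real.exp_nonneg _)
    linarith [Real.add_one_le_exp |Real.log L|, neg_le_abs (Real.log L), Real.log_two_gt_d9]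
  · have hlog : 0 ≤ Real.log (2 * L) := Real.log_nonneg (by linarith)
    rw [farTail, max_eq_right (by linarith : -Real.log (2 * L) ≤ 0), zero_add,
      abs_of_nonneg (Real.log_nonneg h), Real.exp_log hL]
    exact max_le (by linarith) hL.le

theorem farTail_le_exp {L a κ : ℝ} (hL : 0 < L) (hlog : |Real.log L| ≤ a) (hκ : 0 ≤ κ) :
    farTail L ≤ Real.exp ((1 + κ) * a - κ / 2) := by
  rcases le_total a (1 / 2) with ha | ha
  · obtain ⟨hlow, hup⟩ := abs_le.1 (hlog.trans (ha.trans (by linarith [Real.log_two_gt_d9] :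
      (1 : ℝ) / 2 ≤ Real.log 2)))
    rw [← Real.log_inv, Real.log_le_log_iff (by norm_num) hL] at hlow
    rw [Real.log_le_log_iff hL two_pos] at hup
    rw [farTail_eq_zero (by linarith) hup]
    exact Real.exp_nonneg _
  · refine (farTail_le_exp_abs_log hL).trans (Real.exp_le_exp.2 (hlog.trans ?_))
    nlinarith

theorem exp_neg_le_one_div {z : ℝ} (hz : 0 < z) : Real.exp (-z) ≤ 1 / z := by
  rw [Real.exp_neg, ← one_div]
  exact one_div_le_one_div_of_le hz (by linarith [Real.add_one_le_exp z])

theorem max_sq_le_two_mul_exp (z : ℝ) : max z 0 ^ 2 ≤ 2 * Real.exp z := by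
  rcases le_total z 0 with hz | hz
  · rw [max_eq_right hz, zero_pow two_ne_zero]
    positivity
  · rw [max_eq_left hz]
    linarith [Real.quadratic_le_exp_of_nonneg hz]

theorem tail_nonneg {Ω J : Type*} [Fintype J] (g : Ω → ℝ) (ρ b : ℝ) (x : J → Ω) :
    0 ≤ tail g ρ b x :=
  add_nonneg (farTail_nonneg _) (by positivity)

section Tail

variable {Ω J : Type*} [MeasurableSpace Ω] [Fintype J] {g : Ω → ℝ} {ρ b : ℝ}

theorem integrable_abs_score (hg : Measurable g) (hg1 : ∀ a, |g a| ≤ 1) (Q : Measure (J → Ω))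
    [IsFiniteMeasure Q] : Integrable (fun x => |score g x|) Q :=
  Integrable.of_bound (measurable_score hg).abs.aestronglyMeasurable _ (.of_forall fun x => by
    rw [Real.norm_eq_abs, abs_abs]
    exact abs_score_le hg1 x)

theorem integrable_max_score_sq (hg : Measurable g) (hg1 : ∀ a, |g a| ≤ 1) (b : ℝ)
    (Q : Measure (J → Ω)) [IsFiniteMeasure Q] :
    Integrable (fun x => max (|score g x| + 1 - b) 0 ^ 2) Q := by
  refine ((integrable_exp_mul_abs_score hg hg1 1 Q).const_mul (2 * Real.exp (1 - b))).mono' ?_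
    (.of_forall fun x => ?_)
  · have := measurable_score (J := J) hg
    exact (by fun_prop : Measurable _).aestronglyMeasurable
  · rw [Real.norm_of_nonneg (sq_nonneg _), mul_assoc, ← Real.exp_add]
    exact (max_sq_le_two_mul_exp _).trans_eq (by ring_nf)

variable [Nonempty J]

theorem integrable_log_likelihood (hg : Measurable g) (hg1 : ∀ a, |g a| ≤ 1) (hρ : 0 ≤ ρ)
    (hρJ : ρ * √(Fintype.card J) ≤ 1 / 2) (Q : Measure (J → Ω)) [IsFiniteMeasure Q] :
    Integrable (fun x => Real.log (likelihood g ρ x)) Q :=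
  (((integrable_abs_score hg hg1 Q).add (integrable_const 1)).const_mul _).mono'
    (measurable_likelihood hg ρ).log.aestronglyMeasurable
    (.of_forall fun x => abs_log_likelihood_le hg1 hρ hρJ x)

theorem integrable_farTail_likelihood (hg : Measurable g) (hg1 : ∀ a, |g a| ≤ 1) (hρ : 0 ≤ ρ)
    (hρJ : ρ * √(Fintype.card J) ≤ 1 / 2) (Q : Measure (J → Ω)) [IsFiniteMeasure Q] :
    Integrable (fun x => farTail (likelihood g ρ x)) Q :=
  integrable_farTail (likelihood_pos hg1 (abs_le_half_of_mul_sqrt_card_le hρ hρJ))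
    (integrable_likelihood hg hg1 ρ Q) (integrable_log_likelihood hg hg1 hρ hρJ Q)

theorem integrable_tail (hg : Measurable g) (hg1 : ∀ a, |g a| ≤ 1) (hρ : 0 ≤ ρ)
    (hρJ : ρ * √(Fintype.card J) ≤ 1 / 2) (b : ℝ) (Q : Measure (J → Ω)) [IsFiniteMeasure Q] :
    Integrable (tail g ρ b) Q :=
  (integrable_farTail_likelihood hg hg1 hρ hρJ Q).add
    ((integrable_max_score_sq hg hg1 b Q).const_mul _)

theorem integral_tail (hg : Measurable g) (hg1 : ∀ a, |g a| ≤ 1) (hρ : 0 ≤ ρ)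
    (hρJ : ρ * √(Fintype.card J) ≤ 1 / 2) (b : ℝ) (Q : Measure (J → Ω)) [IsFiniteMeasure Q] :
    ∫ x, tail g ρ b x ∂Q = ∫ x, farTail (likelihood g ρ x) ∂Q +
      32 * (ρ * √(Fintype.card J)) ^ 2 * ∫ x, max (|score g x| + 1 - b) 0 ^ 2 ∂Q := by
  rw [← integral_const_mul]
  exact integral_add (integrable_farTail_likelihood hg hg1 hρ hρJ Q)
    ((integrable_max_score_sq hg hg1 b Q).const_mul _)

variable {μ₀ : Measure Ω} [IsProbabilityMeasure μ₀]

theorem integral_max_score_sq_le (hg : Measurable g) (hg1 : ∀ a, |g a| ≤ 1)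
    (h0 : ∫ a, g a ∂μ₀ = 0) (b : ℝ) :
    ∫ x, max (|score g x| + 1 - b) 0 ^ 2 ∂(Measure.pi fun _ : J => μ₀) ≤ 24 * Real.exp (-b) := by
  have hpt : ∀ x : J → Ω, max (|score g x| + 1 - b) 0 ^ 2 ≤
      2 * Real.exp (1 - b) * Real.exp (1 * |score g x|) := fun x => by
    rw [mul_assoc, ← Real.exp_add]
    exact (max_sq_le_two_mul_exp _).trans_eq (by ring_nf)
  have hconst : Real.exp 1 * Real.exp (1 / 2) ≤ 6 :=
    (mul_le_mul Real.exp_one_lt_three.le exp_half_le_two (Real.exp_nonneg _)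
      (by norm_num)).trans_eq (by norm_num)
  calc ∫ x, max (|score g x| + 1 - b) 0 ^ 2 ∂(Measure.pi fun _ : J => μ₀)
      ≤ ∫ x, 2 * Real.exp (1 - b) * Real.exp (1 * |score g x|) ∂(Measure.pi fun _ : J => μ₀) :=
        integral_mono (integrable_max_score_sq hg hg1 b _)
          ((integrable_exp_mul_abs_score hg hg1 1 _).const_mul _) hpt
    _ ≤ 2 * Real.exp (1 - b) * (2 * Real.exp (1 ^ 2 / 2)) := by
        rw [integral_const_mul]
        gcongr
        exact integral_exp_mul_abs_score_le μ₀ hg hg1 h0 1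
    _ = 4 * (Real.exp 1 * Real.exp (1 / 2)) * Real.exp (-b) := by
        rw [sub_eq_add_neg, Real.exp_add]
        ring_nf
    _ ≤ 24 * Real.exp (-b) := by
        gcongr
        linarith

theorem integral_farTail_likelihood_le (hg : Measurable g) (hg1 : ∀ a, |g a| ≤ 1)
    (h0 : ∫ a, g a ∂μ₀ = 0) (hρ : 0 < ρ) (hρJ : ρ * √(Fintype.card J) ≤ 1 / 16) :
    ∫ x, farTail (likelihood g ρ x) ∂(Measure.pi fun _ : J => μ₀) ≤
      2 * Real.exp (-(1 / (32 * (ρ * √(Fintype.card J)) ^ 2))) := by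
  have hε : 0 < ρ * √(Fintype.card J) := by positivity
  have hρJ' : ρ * √(Fintype.card J) ≤ 1 / 2 := hρJ.trans (by norm_num)
  have hpos : ∀ x : J → Ω, 0 < likelihood g ρ x :=
    likelihood_pos hg1 (abs_le_half_of_mul_sqrt_card_le hρ.le hρJ')
  have hlog : ∀ x : J → Ω, |Real.log (likelihood g ρ x)| ≤
      ρ * √(Fintype.card J) * (|score g x| + 1) := abs_log_likelihood_le hg1 hρ.le hρJ'
  have hint := integrable_farTail_likelihood hg hg1 hρ.le hρJ' (Measure.pi fun _ : J => μ₀)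
  set ε := ρ * √(Fintype.card J)
  set κ := 1 / (8 * ε ^ 2) with hκ
  set α := (1 + κ) * ε with hα
  have hexponent : α - κ / 2 + α ^ 2 / 2 ≤ -(1 / (32 * ε ^ 2)) := by
    obtain ⟨u, hu, hεu⟩ : ∃ u, 16 ≤ u ∧ ε = 1 / u :=
      ⟨1 / ε, by rw [le_div_iff₀ hε]; linarith, by field_simp⟩
    have : 0 < u := by linarith
    have hκu : κ = u ^ 2 / 8 := by rw [hκ, hεu]; field_simp
    have hαu : α = 1 / u + u / 8 := by rw [hα, hκu, hεu]; field_simp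
    have hεsq : 1 / (32 * ε ^ 2) = u ^ 2 / 32 := by rw [hεu]; field_simp
    have hinv : 1 / u * u = 1 := by field_simp
    rw [hεsq, hαu, hκu]
    nlinarith
  calc ∫ x, farTail (likelihood g ρ x) ∂(Measure.pi fun _ : J => μ₀)
      ≤ ∫ x, Real.exp (α - κ / 2) * Real.exp (α * |score g x|) ∂(Measure.pi fun _ : J => μ₀) := by
        refine integral_mono hint ((integrable_exp_mul_abs_score hg hg1 α _).const_mul _)
          fun x => (farTail_le_exp (hpos x) (hlog x) (by positivity : 0 ≤ κ)).trans_eq ?_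
        rw [← Real.exp_add, hα]
        ring_nf
    _ ≤ Real.exp (α - κ / 2) * (2 * Real.exp (α ^ 2 / 2)) := by
        rw [integral_const_mul]
        gcongr
        exact integral_exp_mul_abs_score_le μ₀ hg hg1 h0 α
    _ = 2 * Real.exp (α - κ / 2 + α ^ 2 / 2) := by rw [Real.exp_add]; ring
    _ ≤ 2 * Real.exp (-(1 / (32 * ε ^ 2))) := by gcongr

theorem integral_tail_le (hg : Measurable g) (hg1 : ∀ a, |g a| ≤ 1)
    (h0 : ∫ a, g a ∂μ₀ = 0) (hρ : 0 < ρ) (hρJ : ρ * √(Fintype.card J) ≤ 1 / 16)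
    (hb : (ρ * √(Fintype.card J)) ^ 2 * b ≤ 1 / 64) :
    ∫ x, tail g ρ b x ∂(Measure.pi fun _ : J => μ₀) ≤
      896 * (ρ * √(Fintype.card J)) ^ 2 * Real.exp (-b) := by
  have hfar := integral_farTail_likelihood_le hg hg1 h0 hρ hρJ
  have hscore := integral_max_score_sq_le (J := J) hg hg1 h0 b
  have hε : 0 < ρ * √(Fintype.card J) := by positivity
  rw [integral_tail hg hg1 hρ.le (hρJ.trans (by norm_num))]
  set ε := ρ * √(Fintype.card J)
  have hhalf : Real.exp (-(1 / (32 * ε ^ 2))) ≤ 64 * ε ^ 2 * Real.exp (-b) := calc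
    Real.exp (-(1 / (32 * ε ^ 2))) =
        Real.exp (-(1 / (64 * ε ^ 2))) * Real.exp (-(1 / (64 * ε ^ 2))) := by
      rw [← Real.exp_add]
      congr 1
      field_simp
      norm_num
    _ ≤ 1 / (1 / (64 * ε ^ 2)) * Real.exp (-b) := by
      gcongr
      · exact exp_neg_le_one_div (by positivity)
      · rw [le_div_iff₀ (by positivity)]
        linarith
    _ = 64 * ε ^ 2 * Real.exp (-b) := by rw [one_div_one_div]
  have : 32 * ε ^ 2 * _ ≤ 32 * ε ^ 2 * (24 * Real.exp (-b)) :=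
    mul_le_mul_of_nonneg_left hscore (by positivity)
  linarith

end Tail

/-! ### Information revealed by conditioning on an event -/

section Conditioning

variable {Ω I J : Type*} [MeasurableSpace Ω] [Fintype J] {ρ b : ℝ}

theorem integral_likelihood_pos {g : Ω → ℝ} (hg : Measurable g) (hg1 : ∀ a, |g a| ≤ 1)
    (hρ : |ρ| ≤ 1 / 2) (Q : Measure (J → Ω)) [IsProbabilityMeasure Q] :
    0 < ∫ x, likelihood g ρ x ∂Q := by
  have hpos : ∀ x : J → Ω, 0 < likelihood g ρ x := likelihood_pos hg1 hρ
  rw [integral_pos_iff_support_of_nonneg (fun x => (hpos x).le) (integrable_likelihood hg hg1 ρ Q),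
    show Function.support (likelihood (J := J) g ρ) = Set.univ from
      Set.eq_univ_of_forall fun x => (hpos x).ne']
  simp

variable [Nonempty J]

theorem sub_one_sub_log_integral_likelihood_le {g : Ω → ℝ} (hg : Measurable g)
    (hg1 : ∀ a, |g a| ≤ 1) (hρ : 0 < ρ) (hρJ : ρ * √(Fintype.card J) ≤ 1 / 2)
    (hb : 1 / 4 ≤ b) (Q : Measure (J → Ω)) [IsProbabilityMeasure Q] :
    ∫ x, likelihood g ρ x ∂Q - 1 - Real.log (∫ x, likelihood g ρ x ∂Q) ≤
      8 * ((ρ * √(Fintype.card J)) ^ 2 * b) *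
        (min (truncDev Q (likelihood g ρ) / (ρ * √(Fintype.card J))) 1 *
          (truncDev Q (likelihood g ρ) / (ρ * √(Fintype.card J)))) +
      ∫ x, tail g ρ b x ∂Q := by
  have hε : 0 < ρ * √(Fintype.card J) := by positivity
  have hρ2 := abs_le_half_of_mul_sqrt_card_le hρ.le hρJ
  have hpos : ∀ x : J → Ω, 0 < likelihood g ρ x := likelihood_pos hg1 hρ2
  have hL := integrable_likelihood hg hg1 ρ Q
  have hw : Integrable (fun x => |score g x| + 1) Q :=
    (integrable_abs_score hg hg1 Q).add (integrable_const _)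
  have hdev : truncDev Q (likelihood g ρ) / (ρ * √(Fintype.card J)) ≤
      2 * ∫ x, (|score g x| + 1) ∂Q := by
    rw [div_le_iff₀ hε]
    refine (truncDev_le hpos hL hw (abs_log_likelihood_le hg1 hρ.le hρJ)).trans_eq ?_
    ring
  have hsq := sq_le_mul_min_add_integral (b := 4 * b)
    (div_nonneg (truncDev_nonneg Q _) hε.le) hdev (by linarith) hw
    (integrable_max_score_sq hg hg1 _ Q)
  rw [mul_div_cancel_left₀ _ four_ne_zero] at hsq
  have hlog := sub_one_sub_log_integral_le hpos hL (integrable_log_likelihood hg hg1 hρ.le hρJ Q)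
    (integral_likelihood_pos hg hg1 hρ2 Q)
  rw [integral_tail hg hg1 hρ.le hρJ]
  set ε := ρ * √(Fintype.card J)
  have hscale : truncDev Q (likelihood g ρ) ^ 2 =
      ε ^ 2 * (truncDev Q (likelihood g ρ) / ε) ^ 2 := by
    field_simp
  rw [hscale] at hlog
  linarith [mul_le_mul_of_nonneg_left hsq (by positivity : 0 ≤ 2 * ε ^ 2)]

variable [Fintype I] {μ₀ : Measure Ω} [IsProbabilityMeasure μ₀] {g : I → Ω → ℝ}

theorem sum_min_mul_truncDev_le (h : IsNearlyIndependent μ₀ g (Fintype.card J)) (hρ : 0 < ρ)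
    (hρJ : ρ * √(Fintype.card J) ≤ 1 / 16) (Q : Measure (J → Ω)) [IsProbabilityMeasure Q] {p : ℝ}
    (hp : 0 < p) (hQ : Q ≤ ENNReal.ofReal p⁻¹ • Measure.pi fun _ => μ₀) :
    ∑ i, min (truncDev Q (likelihood (g i) ρ) / (ρ * √(Fintype.card J))) 1 *
        (truncDev Q (likelihood (g i) ρ) / (ρ * √(Fintype.card J))) ≤
      16384 * (Real.log p⁻¹ + 1) := by
  have hε : 0 < ρ * √(Fintype.card J) := by positivity
  set ε := ρ * √(Fintype.card J) with hεdef
  set X : I → ℝ := fun i => truncDev Q (likelihood (g i) ρ) / ε with hX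
  have hX0 : ∀ i, 0 ≤ X i := fun i => div_nonneg (truncDev_nonneg _ _) hε.le
  have hmin0 : ∀ i, 0 ≤ min (X i) 1 := fun i => le_min (hX0 i) zero_le_one
  have hterm : ∀ i, min (X i) 1 * X i =
      min (X i) 1 / ε * ∫ x, truncTest Q (likelihood (g i) ρ) x ∂Q := fun i => by
    rcases le_total (∫ x, truncTest Q (likelihood (g i) ρ) x ∂Q) 0 with hneg | hpos
    · simp [hX, truncDev, max_eq_right hneg]
    · simp only [hX, truncDev, max_eq_left hpos]
      ring
  have hmain := sum_mul_integral_truncTest_le h hρ hρJ Q hp hQ (l := fun i => min (X i) 1 / 8192)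
    (fun i => div_nonneg (hmin0 i) (by norm_num)) fun i => by linarith [min_le_right (X i) 1]
  have hlin : ∑ i, min (X i) 1 / 8192 / ε * ∫ x, truncTest Q (likelihood (g i) ρ) x ∂Q =
      (∑ i, min (X i) 1 * X i) / 8192 := by
    rw [Finset.sum_div]
    exact Finset.sum_congr rfl fun i _ => by rw [hterm]; ring
  have hquad : ∑ i, (min (X i) 1 / 8192) ^ 2 ≤ (∑ i, min (X i) 1 * X i) / 8192 ^ 2 := by
    rw [Finset.sum_div]
    refine Finset.sum_le_sum fun i _ => ?_
    rw [div_pow, sq (min (X i) 1)]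
    gcongr
    · exact hmin0 i
    · exact min_le_left _ _
  rw [← hεdef, hlin] at hmain
  linarith

theorem sum_sub_one_sub_log_le (h : IsNearlyIndependent μ₀ g (Fintype.card J)) (hρ : 0 < ρ)
    (hρJ : ρ * √(Fintype.card J) ≤ 1 / 16) (hb : 1 / 4 ≤ b) (Q : Measure (J → Ω))
    [IsProbabilityMeasure Q] {p : ℝ} (hp : 0 < p)
    (hQ : Q ≤ ENNReal.ofReal p⁻¹ • Measure.pi fun _ => μ₀) :
    ∑ i, (∫ x, likelihood (g i) ρ x ∂Q - 1 - Real.log (∫ x, likelihood (g i) ρ x ∂Q)) ≤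
      131072 * ((ρ * √(Fintype.card J)) ^ 2 * b) * (Real.log p⁻¹ + 1) +
        ∑ i, ∫ x, tail (g i) ρ b x ∂Q := by
  refine (Finset.sum_le_sum fun i _ => sub_one_sub_log_integral_likelihood_le (h.measurable i)
    (h.abs_le_one i) hρ (hρJ.trans (by norm_num)) hb Q).trans ?_
  rw [Finset.sum_add_distrib, ← Finset.mul_sum]
  have hscale : 0 ≤ 8 * ((ρ * √(Fintype.card J)) ^ 2 * b) := by positivity
  linarith [mul_le_mul_of_nonneg_left (sum_min_mul_truncDev_le h hρ hρJ Q hp hQ) hscale]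

end Conditioning

/-! ### Relative entropy on finite sets -/

section RelativeEntropy

theorem mul_sub_mul_exp_add_le {p q : ℝ} (hp : 0 ≤ p) (hq : 0 ≤ q) (hpq : q = 0 → p = 0) (f : ℝ) :
    p * f - q * Real.exp f + p ≤ p * Real.log (p / q) := by
  rcases hp.eq_or_lt with rfl | hp
  · simp only [zero_mul, zero_sub, add_zero, Left.neg_nonpos_iff]
    positivity
  · have hq : 0 < q := hq.lt_of_ne fun h => hp.ne' (hpq h.symm)
    have hlog := Real.log_le_sub_one_of_pos (x := q / p * Real.exp f) (by positivity)
    rw [Real.log_mul (by positivity) (by positivity), Real.log_exp, ← inv_div p q,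
      Real.log_inv] at hlog
    have hscaled := mul_le_mul_of_nonneg_left hlog hp.le
    have hcancel : p * ((p / q)⁻¹ * Real.exp f - 1) = q * Real.exp f - p := by field_simp
    linarith

variable {T : Type*} [Fintype T] {p q : T → ℝ}

/-- The relative entropy (Kullback–Leibler divergence) `∑ p log (p / q)` of two probability vectors
on a finite set. It is only used when `q τ = 0` implies `p τ = 0`: otherwise the junk value
`p τ / 0 = 0` would replace the value `∞`. -/
noncomputable def relEntropy (p q : T → ℝ) : ℝ := ∑ τ, p τ * Real.log (p τ / q τ)

theorem log_two_mul_one_sub_sub_le_relEntropy (hp : ∀ τ, 0 ≤ p τ) (hq : ∀ τ, 0 ≤ q τ)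
    (hpq : ∀ τ, q τ = 0 → p τ = 0) (hp1 : ∑ τ, p τ = 1) (hq1 : ∑ τ, q τ = 1) (E : T → Prop)
    [DecidablePred E] :
    Real.log 2 * (1 - ∑ τ with E τ, p τ) - (1 - ∑ τ with E τ, q τ) ≤ relEntropy p q := by
  refine le_trans (le_of_eq ?_) (Finset.sum_le_sum fun τ _ =>
    mul_sub_mul_exp_add_le (hp τ) (hq τ) (hpq τ) (if E τ then 0 else Real.log 2))
  have hterm : ∀ τ, p τ * (if E τ then 0 else Real.log 2) -
      q τ * Real.exp (if E τ then 0 else Real.log 2) + p τ =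
      Real.log 2 * (p τ - if E τ then p τ else 0) - (2 * q τ - if E τ then q τ else 0) + p τ := by
    intro τ
    split_ifs
    · rw [Real.exp_zero]; ring
    · rw [Real.exp_log two_pos]; ring
  simp only [hterm, Finset.sum_add_distrib, Finset.sum_sub_distrib, ← Finset.mul_sum, hp1, hq1,
    Finset.sum_filter]
  ring

theorem sum_negMulLog_le [Nonempty T] (hp : ∀ τ, 0 ≤ p τ) (hp1 : ∑ τ, p τ = 1) :
    ∑ τ, Real.negMulLog (p τ) ≤ Real.log (Fintype.card T) := by
  have hT : (Fintype.card T : ℝ) ≠ 0 := by positivity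
  have hmul : ∀ x : ℝ, x * Real.log (x / (Fintype.card T : ℝ)⁻¹) =
      x * Real.log (Fintype.card T) - Real.negMulLog x := by
    intro x
    rcases eq_or_ne x 0 with rfl | hx
    · simp
    · rw [div_inv_eq_mul, Real.log_mul hx hT, Real.negMulLog]
      ring
  have hsum := Finset.sum_le_sum fun τ (_ : τ ∈ Finset.univ) =>
    mul_sub_mul_exp_add_le (q := (Fintype.card T : ℝ)⁻¹) (hp τ) (by positivity)
      (fun h => absurd h (by positivity)) 0
  simp only [hmul, mul_zero, Real.exp_zero, mul_one, Finset.sum_add_distrib,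
    Finset.sum_sub_distrib, ← Finset.sum_mul, hp1, one_mul, Finset.sum_const, Finset.card_univ,
    nsmul_eq_mul, mul_inv_cancel₀ hT] at hsum
  linarith

end RelativeEntropy

/-! ### Protocols with rectangular transcripts -/

/-- The transcript `tr` of independent inputs indexed by `B` has measurable rectangles as fibers:
`R b τ` is the set of values of the input `b` that are compatible with the transcript `τ`. -/
structure IsRectangular {B Y T : Type*} [MeasurableSpace Y] (tr : (B → Y) → T)
    (R : B → T → Set Y) : Prop where
  measurableSet : ∀ b τ, MeasurableSet (R b τ)
  eq_iff : ∀ X τ, tr X = τ ↔ ∀ b, X b ∈ R b τ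

/-- The hybrid family of the direct sum argument: the measure `ν` at the input `b`, and `P` at all
others. -/
noncomputable def hybrid {B Y : Type*} [DecidableEq B] [MeasurableSpace Y] (P ν : Measure Y)
    (b : B) : B → Measure Y :=
  Function.update (fun _ => P) b ν

section Hybrid

variable {B Y : Type*} [DecidableEq B] [MeasurableSpace Y]

theorem hybrid_self (P ν : Measure Y) (b : B) : hybrid P ν b b = ν := Function.update_self ..

theorem hybrid_of_ne (P ν : Measure Y) {b c : B} (h : c ≠ b) : hybrid P ν b c = P :=
  Function.update_of_ne h ..

instance isFiniteMeasure_hybrid (P ν : Measure Y) [IsFiniteMeasure P] [IsFiniteMeasure ν]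
    (b c : B) : IsFiniteMeasure (hybrid P ν b c) := by
  rcases eq_or_ne c b with rfl | hc
  · rwa [hybrid_self]
  · rwa [hybrid_of_ne P ν hc]

variable [Fintype B]

theorem prod_hybrid_mul (P ν : Measure Y) (b : B) (A : B → Set Y) :
    (∏ c, (hybrid P ν b c).real (A c)) * P.real (A b) =
      ν.real (A b) * ∏ c, P.real (A c) := by
  rw [← Finset.mul_prod_erase _ _ (Finset.mem_univ b),
    ← Finset.mul_prod_erase _ (fun c => P.real (A c)) (Finset.mem_univ b), hybrid_self,
    Finset.prod_congr rfl fun c hc => by rw [hybrid_of_ne P ν (Finset.ne_of_mem_erase hc)]]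
  ring

end Hybrid

theorem measureReal_eq_zero_of_absolutelyContinuous {Y : Type*} [MeasurableSpace Y]
    {P ν : Measure Y} [IsFiniteMeasure P] [IsFiniteMeasure ν] (hPν : P ≪ ν) {S : Set Y}
    (hS : ν.real S = 0) : P.real S = 0 :=
  (measureReal_eq_zero_iff).2 (hPν ((measureReal_eq_zero_iff).1 hS))

namespace IsRectangular

variable {B Y T : Type*} [MeasurableSpace Y] {tr : (B → Y) → T} {R : B → T → Set Y}

theorem preimage_eq (h : IsRectangular tr R) (τ : T) : tr ⁻¹' {τ} = Set.univ.pi fun b => R b τ := by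
  ext X
  simp [h.eq_iff]

section Countable

variable [Countable B]

theorem measurableSet_preimage (h : IsRectangular tr R) (τ : T) : MeasurableSet (tr ⁻¹' {τ}) := by
  rw [h.preimage_eq]
  exact MeasurableSet.univ_pi fun b => h.measurableSet b τ

theorem sum_filter_measureReal [Fintype T] (h : IsRectangular tr R) (ν : Measure (B → Y))
    [IsFiniteMeasure ν] (E : T → Prop) [DecidablePred E] :
    ∑ τ with E τ, ν.real (tr ⁻¹' {τ}) = ν.real {X | E (tr X)} := by
  rw [sum_measureReal_preimage_singleton _ fun τ _ => h.measurableSet_preimage τ]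
  congr 1
  ext X
  simp

theorem sum_measureReal [Fintype T] (h : IsRectangular tr R) (ν : Measure (B → Y))
    [IsFiniteMeasure ν] : ∑ τ, ν.real (tr ⁻¹' {τ}) = ν.real Set.univ := by
  simpa using h.sum_filter_measureReal ν fun _ => True

end Countable

variable [Fintype B]

theorem measureReal_preimage (h : IsRectangular tr R) (ν : B → Measure Y)
    [∀ b, IsFiniteMeasure (ν b)] (τ : T) :
    (Measure.pi ν).real (tr ⁻¹' {τ}) = ∏ b, (ν b).real (R b τ) := by
  rw [h.preimage_eq, measureReal_def, Measure.pi_pi, ENNReal.toReal_prod]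
  rfl

theorem measureReal_pi_eq_zero (h : IsRectangular tr R) {P ν : Measure Y} [IsFiniteMeasure P]
    [IsFiniteMeasure ν] (hPν : P ≪ ν) {τ : T}
    (h0 : (Measure.pi fun _ => ν).real (tr ⁻¹' {τ}) = 0) :
    (Measure.pi fun _ => P).real (tr ⁻¹' {τ}) = 0 := by
  rw [h.measureReal_preimage, Finset.prod_eq_zero_iff] at h0 ⊢
  obtain ⟨b, hb, h0⟩ := h0
  exact ⟨b, hb, measureReal_eq_zero_of_absolutelyContinuous hPν h0⟩

theorem log_measureReal_div (h : IsRectangular tr R) {P ν : Measure Y} [IsFiniteMeasure P]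
    [IsFiniteMeasure ν] {τ : T}
    (hP : ∀ b, P.real (R b τ) ≠ 0) (hν : ∀ b, ν.real (R b τ) ≠ 0) :
    Real.log ((Measure.pi fun _ => P).real (tr ⁻¹' {τ}) /
        (Measure.pi fun _ => ν).real (tr ⁻¹' {τ})) =
      ∑ b, -Real.log (ν.real (R b τ) / P.real (R b τ)) := by
  rw [h.measureReal_preimage, h.measureReal_preimage, ← Finset.prod_div_distrib,
    Real.log_prod fun b _ => div_ne_zero (hP b) (hν b)]
  exact Finset.sum_congr rfl fun b _ => by rw [← Real.log_inv, inv_div]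

section Hybrid

variable [DecidableEq B]

theorem sum_measureReal_hybrid [Fintype T] (h : IsRectangular tr R) (P ν : Measure Y)
    [IsProbabilityMeasure P] [IsFiniteMeasure ν] (b : B) :
    ∑ τ, (Measure.pi (hybrid P ν b)).real (tr ⁻¹' {τ}) = ν.real Set.univ := by
  have := prod_hybrid_mul P ν b fun _ => Set.univ
  rw [h.sum_measureReal, measureReal_def, Measure.pi_univ, ENNReal.toReal_prod]
  simpa [measureReal_def] using this

theorem measureReal_hybrid_eq_zero (h : IsRectangular tr R) {P ν : Measure Y} [IsFiniteMeasure P]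
    [IsFiniteMeasure ν] (hνP : ν ≪ P) {τ : T}
    (h0 : (Measure.pi fun _ => P).real (tr ⁻¹' {τ}) = 0) (b : B) :
    (Measure.pi (hybrid P ν b)).real (tr ⁻¹' {τ}) = 0 := by
  rw [h.measureReal_preimage, Finset.prod_eq_zero_iff] at h0 ⊢
  obtain ⟨c, hc, h0⟩ := h0
  refine ⟨c, hc, ?_⟩
  rcases eq_or_ne c b with rfl | hcb
  · rw [hybrid_self]
    exact measureReal_eq_zero_of_absolutelyContinuous hνP h0
  · rwa [hybrid_of_ne P ν hcb]

theorem measureReal_hybrid_eq_mul_div (h : IsRectangular tr R) {P ν : Measure Y}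
    [IsFiniteMeasure P] [IsFiniteMeasure ν] {τ : T} {b : B} (hb : P.real (R b τ) ≠ 0) :
    (Measure.pi (hybrid P ν b)).real (tr ⁻¹' {τ}) =
      (Measure.pi fun _ => P).real (tr ⁻¹' {τ}) * (ν.real (R b τ) / P.real (R b τ)) := by
  rw [h.measureReal_preimage, h.measureReal_preimage, mul_div, eq_div_iff hb, prod_hybrid_mul,
    mul_comm]

end Hybrid

section DirectSum

variable {I : Type*} [Fintype I] {P δ : Measure Y} [IsProbabilityMeasure P] [IsFiniteMeasure δ]
  {ν : I → Measure Y} [∀ i, IsProbabilityMeasure (ν i)] {K : ℝ}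

theorem sum_mul_log_measureReal_div_le [DecidableEq B] (h : IsRectangular tr R) (hνP : ∀ i, ν i ≪ P)
    (hPν : ∀ i, P ≪ ν i)
    (hinfo : ∀ S, MeasurableSet S → 0 < P.real S →
      ∑ i, ((ν i).real S / P.real S - 1 - Real.log ((ν i).real S / P.real S)) ≤
        K * (1 - Real.log (P.real S)) + δ.real S / P.real S) (τ : T) :
    ∑ i, (Measure.pi fun _ => P).real (tr ⁻¹' {τ}) *
        Real.log ((Measure.pi fun _ => P).real (tr ⁻¹' {τ}) /
          (Measure.pi fun _ => ν i).real (tr ⁻¹' {τ})) ≤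
      ∑ b, ∑ i, ((Measure.pi fun _ => P).real (tr ⁻¹' {τ}) -
          (Measure.pi (hybrid P (ν i) b)).real (tr ⁻¹' {τ})) +
        K * (Real.negMulLog ((Measure.pi fun _ => P).real (tr ⁻¹' {τ})) +
          Fintype.card B * (Measure.pi fun _ => P).real (tr ⁻¹' {τ})) +
        ∑ b, (Measure.pi (hybrid P δ b)).real (tr ⁻¹' {τ}) := by
  rcases measureReal_nonneg.eq_or_lt' (a := (Measure.pi fun _ => P).real (tr ⁻¹' {τ}))
    with hzero | hpos
  · simp only [hzero, h.measureReal_hybrid_eq_zero (hνP _) hzero, zero_mul, mul_zero, sub_self,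
      Finset.sum_const_zero, Real.negMulLog_zero, add_zero, zero_add]
    exact Finset.sum_nonneg fun b _ => measureReal_nonneg
  have hprod := h.measureReal_preimage (fun _ => P) τ
  have hPR : ∀ b, P.real (R b τ) ≠ 0 := fun b hb =>
    hpos.ne' (hprod.trans (Finset.prod_eq_zero (Finset.mem_univ b) hb))
  have hνR : ∀ i b, (ν i).real (R b τ) ≠ 0 := fun i b hb =>
    hPR b (measureReal_eq_zero_of_absolutelyContinuous (hPν i) hb)
  have hlog : Real.log ((Measure.pi fun _ => P).real (tr ⁻¹' {τ})) =
      ∑ b, Real.log (P.real (R b τ)) := by rw [hprod, Real.log_prod fun b _ => hPR b]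
  simp only [h.log_measureReal_div hPR (hνR _), h.measureReal_hybrid_eq_mul_div (hPR _)]
  set p := (Measure.pi fun _ => P).real (tr ⁻¹' {τ})
  set r : I → B → ℝ := fun i b => (ν i).real (R b τ) / P.real (R b τ)
  calc ∑ i, p * ∑ b, -Real.log (r i b)
      = ∑ b, ∑ i, (p - p * r i b) + p * ∑ b, ∑ i, (r i b - 1 - Real.log (r i b)) := by
        simp_rw [Finset.mul_sum, ← Finset.sum_add_distrib]
        rw [Finset.sum_comm]
        exact Finset.sum_congr rfl fun b _ => Finset.sum_congr rfl fun i _ => by ring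
    _ ≤ ∑ b, ∑ i, (p - p * r i b) + p * ∑ b, (K * (1 - Real.log (P.real (R b τ))) +
          δ.real (R b τ) / P.real (R b τ)) := by
        gcongr with b _
        exact hinfo _ (h.measurableSet b τ) (measureReal_nonneg.lt_of_ne' (hPR b))
    _ = _ := by
        simp only [Finset.sum_add_distrib, ← Finset.mul_sum, Finset.sum_sub_distrib, ← hlog,
          Real.negMulLog, Finset.sum_const, Finset.card_univ, nsmul_eq_mul]
        ring

variable [Fintype T] [Nonempty T]

theorem sum_relEntropy_le (h : IsRectangular tr R) (hK : 0 ≤ K) (hνP : ∀ i, ν i ≪ P)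
    (hPν : ∀ i, P ≪ ν i)
    (hinfo : ∀ S, MeasurableSet S → 0 < P.real S →
      ∑ i, ((ν i).real S / P.real S - 1 - Real.log ((ν i).real S / P.real S)) ≤
        K * (1 - Real.log (P.real S)) + δ.real S / P.real S) :
    ∑ i, relEntropy (fun τ => (Measure.pi fun _ => P).real (tr ⁻¹' {τ}))
        (fun τ => (Measure.pi fun _ => ν i).real (tr ⁻¹' {τ})) ≤
      K * (Real.log (Fintype.card T) + Fintype.card B) + Fintype.card B * δ.real Set.univ := by
  classical
  have hP1 : ∑ τ, (Measure.pi fun _ => P).real (tr ⁻¹' {τ}) = 1 := by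
    rw [h.sum_measureReal, probReal_univ]
  have hcancel : ∑ τ, ∑ b, ∑ i, ((Measure.pi fun _ => P).real (tr ⁻¹' {τ}) -
      (Measure.pi (hybrid P (ν i) b)).real (tr ⁻¹' {τ})) = 0 := by
    rw [Finset.sum_comm]
    refine Finset.sum_eq_zero fun b _ => ?_
    rw [Finset.sum_comm]
    refine Finset.sum_eq_zero fun i _ => ?_
    rw [Finset.sum_sub_distrib, hP1, h.sum_measureReal_hybrid, probReal_univ, sub_self]
  have hentropy := sum_negMulLog_le (fun τ : T => measureReal_nonneg) hP1
  have hδ : ∑ τ, ∑ b, (Measure.pi (hybrid P δ b)).real (tr ⁻¹' {τ}) =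
      Fintype.card B * δ.real Set.univ := by
    rw [Finset.sum_comm]
    simp [h.sum_measureReal_hybrid]
  simp only [relEntropy]
  rw [Finset.sum_comm]
  refine (Finset.sum_le_sum fun τ _ =>
    h.sum_mul_log_measureReal_div_le hνP hPν hinfo τ).trans ?_
  rw [Finset.sum_add_distrib, Finset.sum_add_distrib, hcancel, hδ, ← Finset.mul_sum,
    Finset.sum_add_distrib, ← Finset.mul_sum, hP1, mul_one, zero_add]
  gcongr

end DirectSum

end IsRectangular

/-! ### Perturbed product measures -/

theorem measureReal_withDensity_ofReal {Y : Type*} [MeasurableSpace Y] {P : Measure Y}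
    {f : Y → ℝ} (hf : Integrable f P) (hf0 : ∀ x, 0 ≤ f x) {S : Set Y} (hS : MeasurableSet S) :
    (P.withDensity fun x => ENNReal.ofReal (f x)).real S = ∫ x in S, f x ∂P := by
  rw [measureReal_def, withDensity_apply _ hS, ← ofReal_integral_eq_lintegral_ofReal
    hf.integrableOn (.of_forall hf0), ENNReal.toReal_ofReal (integral_nonneg hf0)]

section Perturb

variable {Ω J : Type*} [MeasurableSpace Ω] [Fintype J] {μ₀ : Measure Ω} [IsProbabilityMeasure μ₀]
  {g : Ω → ℝ} {θ : ℝ}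

theorem measureReal_perturb_univ (hg : Measurable g) (hg1 : ∀ a, |g a| ≤ 1) (hθ : |θ| ≤ 1 / 2) :
    (perturb μ₀ θ g).real Set.univ = 1 + θ * ∫ a, g a ∂μ₀ := by
  have hint : Integrable g μ₀ := .of_bound hg.aestronglyMeasurable 1 (.of_forall hg1)
  rw [perturb, measureReal_withDensity_ofReal (f := fun a => 1 + θ * g a)
    ((integrable_const 1).add (hint.const_mul θ)) (fun a => (one_add_mul_pos hg1 hθ a).le) .univ,
    setIntegral_univ, integral_add (integrable_const 1) (hint.const_mul θ), integral_const_mul]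
  simp

theorem isProbabilityMeasure_perturb (hg : Measurable g) (hg1 : ∀ a, |g a| ≤ 1)
    (h0 : ∫ a, g a ∂μ₀ = 0) (hθ : |θ| ≤ 1 / 2) : IsProbabilityMeasure (perturb μ₀ θ g) := by
  have huniv := measureReal_perturb_univ (μ₀ := μ₀) hg hg1 hθ
  rw [h0, mul_zero, add_zero, measureReal_def, ENNReal.toReal_eq_one_iff] at huniv
  exact ⟨huniv⟩

theorem measureReal_pi_perturb (hg : Measurable g) (hg1 : ∀ a, |g a| ≤ 1) (hθ : |θ| ≤ 1 / 2)
    {S : Set (J → Ω)} (hS : MeasurableSet S) :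
    (Measure.pi fun _ => perturb μ₀ θ g).real S =
      ∫ x in S, likelihood g θ x ∂(Measure.pi fun _ => μ₀) := by
  rw [pi_perturb μ₀ hg hg1 hθ, measureReal_withDensity_ofReal (integrable_likelihood hg hg1 θ _)
    (fun x => (likelihood_pos hg1 hθ x).le) hS]

theorem pi_perturb_absolutelyContinuous (hg : Measurable g) (hg1 : ∀ a, |g a| ≤ 1)
    (hθ : |θ| ≤ 1 / 2) :
    (Measure.pi fun _ : J => perturb μ₀ θ g) ≪ Measure.pi fun _ => μ₀ := by
  rw [pi_perturb μ₀ hg hg1 hθ]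
  exact withDensity_absolutelyContinuous _ _

theorem absolutelyContinuous_pi_perturb (hg : Measurable g) (hg1 : ∀ a, |g a| ≤ 1)
    (hθ : |θ| ≤ 1 / 2) :
    (Measure.pi fun _ : J => μ₀) ≪ Measure.pi fun _ => perturb μ₀ θ g := by
  rw [pi_perturb μ₀ hg hg1 hθ]
  exact withDensity_absolutelyContinuous'
    (measurable_likelihood hg θ).ennreal_ofReal.aemeasurable
    (.of_forall fun x => by simpa using likelihood_pos hg1 hθ x)

end Perturb

section Conditioning

variable {Y : Type*} [MeasurableSpace Y] {P : Measure Y}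

theorem integral_cond_eq_div (f : Y → ℝ) (S : Set Y) :
    ∫ x, f x ∂(ProbabilityTheory.cond P S) = (∫ x in S, f x ∂P) / P.real S := by
  rw [ProbabilityTheory.cond, integral_smul_measure, ENNReal.toReal_inv, smul_eq_mul,
    measureReal_def]
  ring

theorem cond_le_smul [IsFiniteMeasure P] {S : Set Y} (hS : 0 < P.real S) :
    ProbabilityTheory.cond P S ≤ ENNReal.ofReal (P.real S)⁻¹ • P := by
  rw [ProbabilityTheory.cond, ENNReal.ofReal_inv_of_pos hS, ofReal_measureReal]
  intro A
  simp only [Measure.smul_apply, smul_eq_mul]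
  gcongr
  exact Measure.restrict_le_self

end Conditioning

/-! ### Information in a rectangular transcript -/

section Information

variable {Ω I J : Type*} [MeasurableSpace Ω] [Fintype I] [Fintype J] [Nonempty J] {μ₀ : Measure Ω}
  {g : I → Ω → ℝ} {ρ b : ℝ}

theorem integrable_sum_tail (h : IsNearlyIndependent μ₀ g (Fintype.card J)) (hρ : 0 < ρ)
    (hρJ : ρ * √(Fintype.card J) ≤ 1 / 16) (b : ℝ) (Q : Measure (J → Ω)) [IsFiniteMeasure Q] :
    Integrable (fun x => ∑ i, tail (g i) ρ b x) Q :=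
  integrable_finsetSum _ fun i _ =>
    integrable_tail (h.measurable i) (h.abs_le_one i) hρ.le (hρJ.trans (by norm_num)) b Q

variable [IsProbabilityMeasure μ₀]

theorem IsNearlyIndependent.isProbabilityMeasure_perturb {n : ℕ} (h : IsNearlyIndependent μ₀ g n)
    (hρ : |ρ| ≤ 1 / 2) (i : I) : IsProbabilityMeasure (perturb μ₀ ρ (g i)) :=
  _root_.isProbabilityMeasure_perturb (h.measurable i) (h.abs_le_one i) (h.integral_eq_zero i) hρ

theorem sum_sub_one_sub_log_measureReal_div_le (h : IsNearlyIndependent μ₀ g (Fintype.card J))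
    (hρ : 0 < ρ) (hρJ : ρ * √(Fintype.card J) ≤ 1 / 16) (hb : 1 / 4 ≤ b) {S : Set (J → Ω)}
    (hS : MeasurableSet S) (hpos : 0 < (Measure.pi fun _ => μ₀).real S) :
    ∑ i, ((Measure.pi fun _ => perturb μ₀ ρ (g i)).real S / (Measure.pi fun _ => μ₀).real S - 1 -
        Real.log ((Measure.pi fun _ => perturb μ₀ ρ (g i)).real S /
          (Measure.pi fun _ => μ₀).real S)) ≤
      131072 * ((ρ * √(Fintype.card J)) ^ 2 * b) *
          (1 - Real.log ((Measure.pi fun _ => μ₀).real S)) +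
        ((Measure.pi fun _ => μ₀).withDensity fun x =>
          ENNReal.ofReal (∑ i, tail (g i) ρ b x)).real S / (Measure.pi fun _ => μ₀).real S := by
  have hρ2 := abs_le_half_of_mul_sqrt_card_le hρ.le (hρJ.trans (by norm_num))
  have := ProbabilityTheory.cond_isProbabilityMeasure fun hnull : (Measure.pi fun _ => μ₀) S = 0 =>
    hpos.ne' (by rw [measureReal_def, hnull, ENNReal.toReal_zero])
  have hinfo := sum_sub_one_sub_log_le h hρ hρJ hb _ hpos (cond_le_smul hpos)
  rw [measureReal_withDensity_ofReal (integrable_sum_tail h hρ hρJ b _)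
    (fun x => Finset.sum_nonneg fun i _ => tail_nonneg _ _ _ _) hS, ← integral_cond_eq_div,
    integral_finsetSum _ fun i _ => integrable_tail (h.measurable i) (h.abs_le_one i) hρ.le
      (hρJ.trans (by norm_num)) b _, sub_eq_neg_add, ← Real.log_inv]
  simpa only [measureReal_pi_perturb (h.measurable _) (h.abs_le_one _) hρ2 hS,
    ← integral_cond_eq_div] using hinfo

theorem half_le_log {k : ℕ} (hk : 2 ≤ k) : 1 / 2 ≤ Real.log k := by
  have hlog : Real.log 2 ≤ Real.log k := Real.log_le_log two_pos (by exact_mod_cast hk)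
  linarith [Real.log_two_gt_d9]

theorem measureReal_withDensity_sum_tail_le (h : IsNearlyIndependent μ₀ g (Fintype.card J))
    (hρ : 0 < ρ) (hρJ : ρ * √(Fintype.card J) ≤ 1 / 16) (hI : 2 ≤ Fintype.card I)
    (hρI : (ρ * √(Fintype.card J)) ^ 2 * Real.log (Fintype.card I) ≤ 1 / 64) :
    ((Measure.pi fun _ : J => μ₀).withDensity fun x =>
        ENNReal.ofReal (∑ i, tail (g i) ρ (Real.log (Fintype.card I)) x)).real Set.univ ≤
      131072 * ((ρ * √(Fintype.card J)) ^ 2 * Real.log (Fintype.card I)) := by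
  have hlog := half_le_log hI
  have hI0 : (0 : ℝ) < Fintype.card I := by exact_mod_cast two_pos.trans_le hI
  rw [measureReal_withDensity_ofReal (integrable_sum_tail h hρ hρJ _ _)
    (fun x => Finset.sum_nonneg fun i _ => tail_nonneg _ _ _ _) .univ, setIntegral_univ,
    integral_finsetSum _ fun i _ => integrable_tail (h.measurable i) (h.abs_le_one i) hρ.le
      (hρJ.trans (by norm_num)) _ _]
  calc ∑ i, ∫ x, tail (g i) ρ (Real.log (Fintype.card I)) x ∂(Measure.pi fun _ : J => μ₀)
      ≤ ∑ _i : I, 896 * (ρ * √(Fintype.card J)) ^ 2 * (Fintype.card I : ℝ)⁻¹ := by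
        refine Finset.sum_le_sum fun i _ => ?_
        have := integral_tail_le (h.measurable i) (h.abs_le_one i) (h.integral_eq_zero i) hρ hρJ hρI
        rwa [Real.exp_neg, Real.exp_log hI0] at this
    _ = 896 * (ρ * √(Fintype.card J)) ^ 2 := by
        rw [Finset.sum_const, Finset.card_univ, nsmul_eq_mul]
        field_simp
    _ ≤ 131072 * ((ρ * √(Fintype.card J)) ^ 2 * Real.log (Fintype.card I)) := by
        nlinarith [mul_le_mul_of_nonneg_left hlog (sq_nonneg (ρ * √(Fintype.card J)))]

variable {B T : Type*} [Fintype B] [Fintype T] [Nonempty T]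
  {tr : (B → J → Ω) → T} {R : B → T → Set (J → Ω)}

theorem IsRectangular.sum_relEntropy_perturb_le (hrect : IsRectangular tr R)
    (h : IsNearlyIndependent μ₀ g (Fintype.card J)) (hρ : 0 < ρ)
    (hρJ : ρ * √(Fintype.card J) ≤ 1 / 16) (hI : 2 ≤ Fintype.card I)
    (hρI : (ρ * √(Fintype.card J)) ^ 2 * Real.log (Fintype.card I) ≤ 1 / 64) :
    ∑ i, relEntropy (fun τ => (Measure.pi fun _ => Measure.pi fun _ => μ₀).real (tr ⁻¹' {τ}))
        (fun τ => (Measure.pi fun _ => Measure.pi fun _ => perturb μ₀ ρ (g i)).real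
          (tr ⁻¹' {τ})) ≤
      131072 * ((ρ * √(Fintype.card J)) ^ 2 * Real.log (Fintype.card I)) *
        (Real.log (Fintype.card T) + 2 * Fintype.card B) := by
  classical
  have hρ2 := abs_le_half_of_mul_sqrt_card_le hρ.le (hρJ.trans (by norm_num))
  have hlog := half_le_log hI
  have := h.isProbabilityMeasure_perturb hρ2
  have := isFiniteMeasure_withDensity_ofReal
    (integrable_sum_tail h hρ hρJ (Real.log (Fintype.card I)) (Measure.pi fun _ => μ₀)).2
  have htail := measureReal_withDensity_sum_tail_le h hρ hρJ hI hρI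
  refine (hrect.sum_relEntropy_le (K := 131072 * ((ρ * √(Fintype.card J)) ^ 2 *
    Real.log (Fintype.card I))) (by positivity)
    (fun i => pi_perturb_absolutelyContinuous (h.measurable i) (h.abs_le_one i) hρ2)
    (fun i => absolutelyContinuous_pi_perturb (h.measurable i) (h.abs_le_one i) hρ2)
    fun S hS hpos => sum_sub_one_sub_log_measureReal_div_le h hρ hρJ (by linarith) hS hpos).trans ?_
  linarith [mul_le_mul_of_nonneg_left htail (Nat.cast_nonneg (Fintype.card B))]

end Information

/-! ### The cost of identification -/

section Identification

theorem card_div_le_sum_log_two_mul {I : Type*} [Fintype I] (hI : 2 ≤ Fintype.card I) {p : I → ℝ}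
    (hp : ∑ i, p i = 1) :
    (Fintype.card I : ℝ) / 100 ≤ ∑ i, (Real.log 2 * (1 - p i) - 1 / 3) := by
  have hI : (2 : ℝ) ≤ Fintype.card I := by exact_mod_cast hI
  simp only [Finset.sum_sub_distrib, ← Finset.mul_sum, hp, Finset.sum_const, Finset.card_univ,
    nsmul_eq_mul, mul_one]
  nlinarith [Real.log_two_gt_d9]

theorem log_two_mul_sub_setIntegral_le {Y : Type*} [MeasurableSpace Y] {P : Measure Y}
    [IsProbabilityMeasure P] {L W : Y → ℝ} (hL : ∀ x, 0 < L x) (hLint : Integrable L P)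
    (hL1 : ∫ x, L x ∂P = 1) (hW : Integrable W P) (hLW : ∀ x, -W x ≤ Real.log (L x)) {F : Set Y}
    (hF : MeasurableSet F) : Real.log 2 * P.real F - ∫ x in F, L x ∂P ≤ ∫ x, W x ∂P := by
  have hind : Integrable (F.indicator fun x => Real.log 2 - L x) P :=
    ((integrable_const _).sub hLint).indicator hF
  have hpoint : ∀ x, F.indicator (fun x => Real.log 2 - L x) x ≤ W x - 1 + L x := by
    intro x
    have hrel := mul_sub_mul_exp_add_le zero_le_one (hL x).le (fun h => absurd h (hL x).ne')
      (F.indicator (fun _ => Real.log 2) x)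
    rw [one_div, Real.log_inv] at hrel
    by_cases hx : x ∈ F
    · rw [Set.indicator_of_mem hx] at hrel ⊢
      rw [Real.exp_log two_pos] at hrel
      linarith [hLW x]
    · rw [Set.indicator_of_notMem hx] at hrel ⊢
      rw [Real.exp_zero] at hrel
      linarith [hLW x]
  have hmono := integral_mono hind ((hW.sub (integrable_const 1)).add hLint) hpoint
  rw [integral_indicator hF, integral_sub (integrable_const _) hLint.integrableOn,
    setIntegral_const, smul_eq_mul, mul_comm] at hmono
  refine hmono.trans_eq ?_
  rw [integral_add' (hW.sub (integrable_const 1)) hLint, integral_sub' hW (integrable_const 1),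
    hL1]
  simp

variable {Ω J : Type*} [MeasurableSpace Ω] [Fintype J] {μ₀ : Measure Ω}
  [IsProbabilityMeasure μ₀]

theorem integral_score_eq_zero {g : Ω → ℝ} (hg : Measurable g) (hg1 : ∀ a, |g a| ≤ 1)
    (h0 : ∫ a, g a ∂μ₀ = 0) : ∫ x, score g x ∂(Measure.pi fun _ : J => μ₀) = 0 := by
  have hint : ∀ j : J, Integrable (fun x : J → Ω => g (x j)) (Measure.pi fun _ => μ₀) := fun j =>
    .of_bound (hg.comp (measurable_pi_apply j)).aestronglyMeasurable 1 (.of_forall fun x => hg1 _)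
  unfold score
  rw [integral_div, integral_finsetSum _ fun j _ => hint j]
  simp [integral_comp_eval (μ := fun _ : J => μ₀) hg.aestronglyMeasurable, h0]

theorem log_two_mul_one_sub_sub_le_sq_mul_card {g : Ω → ℝ} {ρ : ℝ} (hg : Measurable g)
    (hg1 : ∀ a, |g a| ≤ 1) (h0 : ∫ a, g a ∂μ₀ = 0) (hρ : |ρ| ≤ 1 / 2) {E : Set (J → Ω)}
    (hE : MeasurableSet E) :
    Real.log 2 * (1 - (Measure.pi fun _ => μ₀).real E) -
        (1 - (Measure.pi fun _ => perturb μ₀ ρ g).real E) ≤ 2 * ρ ^ 2 * Fintype.card J := by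
  have := isProbabilityMeasure_perturb hg hg1 h0 hρ
  have hscore : Integrable (fun x : J → Ω => ρ * √(Fintype.card J) * score g x)
      (Measure.pi fun _ => μ₀) :=
    .const_mul (.of_bound (measurable_score hg).aestronglyMeasurable _
      (.of_forall (abs_score_le hg1))) _
  rw [← probReal_compl_eq_one_sub hE, ← probReal_compl_eq_one_sub hE,
    measureReal_pi_perturb hg hg1 hρ hE.compl]
  refine (log_two_mul_sub_setIntegral_le (likelihood_pos hg1 hρ) (integrable_likelihood hg hg1 ρ _)
    ?_ ((integrable_const (2 * ρ ^ 2 * Fintype.card J)).sub hscore)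
    (fun x => ?_) hE.compl).trans_eq ?_
  · rw [← setIntegral_univ, ← measureReal_pi_perturb hg hg1 hρ .univ, probReal_univ]
  · rw [Pi.sub_apply, neg_sub]
    exact le_log_likelihood hg1 hρ x
  · have hzero : ∫ x : J → Ω, ρ * √(Fintype.card J) * score g x ∂(Measure.pi fun _ => μ₀) = 0 := by
      rw [integral_const_mul, integral_score_eq_zero hg hg1 h0, mul_zero]
    rw [integral_sub' (integrable_const _) hscore, hzero]
    simp

variable {I : Type*} [Fintype I] {g : I → Ω → ℝ} {ρ : ℝ}

theorem le_sq_mul_card_of_identifies (hI : 2 ≤ Fintype.card I) (hg : ∀ i, Measurable (g i))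
    (hg1 : ∀ i a, |g i a| ≤ 1) (h0 : ∀ i, ∫ a, g i a ∂μ₀ = 0) (hρ : |ρ| ≤ 1 / 2)
    {out : (J → Ω) → I} (hmeas : ∀ i, MeasurableSet (out ⁻¹' {i}))
    (hout : ∀ i, 2 / 3 ≤ (Measure.pi fun _ => perturb μ₀ ρ (g i)).real (out ⁻¹' {i})) :
    1 / 200 ≤ ρ ^ 2 * Fintype.card J := by
  have hone : ∑ i, (Measure.pi fun _ => μ₀).real (out ⁻¹' {i}) = 1 := by
    rw [sum_measureReal_preimage_singleton _ fun i _ => hmeas i]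
    simp
  have hcost : ∀ i, Real.log 2 * (1 - (Measure.pi fun _ => μ₀).real (out ⁻¹' {i})) - 1 / 3 ≤
      2 * ρ ^ 2 * Fintype.card J := fun i => by
    linarith [log_two_mul_one_sub_sub_le_sq_mul_card (hg i) (hg1 i) (h0 i) hρ (hmeas i), hout i]
  have hsum := (card_div_le_sum_log_two_mul hI hone).trans (Finset.sum_le_sum fun i _ => hcost i)
  rw [Finset.sum_const, Finset.card_univ, nsmul_eq_mul, div_eq_mul_one_div] at hsum
  linarith [le_of_mul_le_mul_left hsum (by exact_mod_cast two_pos.trans_le hI)]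

theorem IsRectangular.card_le_of_identifies [Nonempty J] {B T : Type*} [Fintype B] [Fintype T]
    [Nonempty T] {tr : (B → J → Ω) → T} {R : B → T → Set (J → Ω)} (hrect : IsRectangular tr R)
    (h : IsNearlyIndependent μ₀ g (Fintype.card J)) (hρ : 0 < ρ)
    (hρJ : ρ * √(Fintype.card J) ≤ 1 / 16) (hI : 2 ≤ Fintype.card I)
    (hρI : (ρ * √(Fintype.card J)) ^ 2 * Real.log (Fintype.card I) ≤ 1 / 64) (out : T → I)
    (hout : ∀ i, 2 / 3 ≤
      (Measure.pi fun _ : B => Measure.pi fun _ => perturb μ₀ ρ (g i)).real {X | out (tr X) = i}) :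
    (Fintype.card I : ℝ) / 100 ≤
      131072 * ((ρ * √(Fintype.card J)) ^ 2 * Real.log (Fintype.card I)) *
        (Real.log (Fintype.card T) + 2 * Fintype.card B) := by
  classical
  have hρ2 := abs_le_half_of_mul_sqrt_card_le hρ.le (hρJ.trans (by norm_num))
  have := h.isProbabilityMeasure_perturb hρ2
  refine le_trans ?_ (hrect.sum_relEntropy_perturb_le h hρ hρJ hI hρI)
  refine (card_div_le_sum_log_two_mul hI (p := fun i =>
    ∑ τ with out τ = i, (Measure.pi fun _ => Measure.pi fun _ => μ₀).real (tr ⁻¹' {τ})) ?_).trans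
    (Finset.sum_le_sum fun i _ => ?_)
  · exact (Finset.sum_fiberwise _ _ _).trans (by rw [hrect.sum_measureReal, probReal_univ])
  · have hcost := log_two_mul_one_sub_sub_le_relEntropy (fun _ => measureReal_nonneg)
      (fun _ => measureReal_nonneg)
      (fun τ => hrect.measureReal_pi_eq_zero (τ := τ) (absolutelyContinuous_pi_perturb
        (μ₀ := μ₀) (h.measurable i) (h.abs_le_one i) hρ2))
      (by rw [hrect.sum_measureReal, probReal_univ]) (by rw [hrect.sum_measureReal, probReal_univ])
      (fun τ => out τ = i)
    rw [hrect.sum_filter_measureReal (Measure.pi fun _ => Measure.pi fun _ =>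
      perturb μ₀ ρ (g i))] at hcost
    linarith [hout i]

end Identification

/-! ### Transcripts of sequential protocols -/

section Trajectory

variable {U Y : Type*}

/-- The state at time `q` of a machine started in the state `u` whose `q`-th transition reads
`y q`; unlike `StreamAlg.memory`, it allows any state space and any start. -/
def trajectory (F : ℕ → Y → U → U) (u : U) (y : ℕ → Y) : ℕ → U
  | 0 => u
  | q + 1 => F q (y q) (trajectory F u y q)

variable {F : ℕ → Y → U → U} {u : U}

theorem trajectory_add (y : ℕ → Y) (j m : ℕ) :
    trajectory F u y (j + m) =
      trajectory (fun i => F (j + i)) (trajectory F u y j) (fun i => y (j + i)) m := by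
  induction m with
  | zero => rfl
  | succ m ih => rw [← add_assoc, trajectory, trajectory, ih]

theorem trajectory_congr {y z : ℕ → Y} {m : ℕ} (h : ∀ i < m, y i = z i) :
    trajectory F u y m = trajectory F u z m := by
  induction m with
  | zero => rfl
  | succ m ih => rw [trajectory, trajectory, ih fun i hi => h i (hi.trans m.lt_succ_self),
      h m m.lt_succ_self]

theorem measurable_trajectory [MeasurableSpace U] [Countable U] [MeasurableSingletonClass U]
    [MeasurableSpace Y] (hF : ∀ q v, Measurable fun y => F q y v) {X : Type*} [MeasurableSpace X]
    {y : X → ℕ → Y} (hy : ∀ j, Measurable fun x => y x j) (m : ℕ) :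
    Measurable fun x => trajectory F u (y x) m := by
  induction m with
  | zero => exact measurable_const
  | succ m ih =>
    have hstep : Measurable fun z : U × Y => F m z.2 z.1 :=
      measurable_from_prod_countable_right (hF m)
    exact hstep.comp (ih.prodMk (hy m))

variable {B : Type*} {M : ℕ}

/-- The inputs of participant `b` that are compatible with a transcript `τ`, in the protocol whose
`q`-th message is sent by participant `c q`. -/
def compatibleInputs (F : ℕ → Y → U → U) (u : U) (c : ℕ → B) (b : B) (τ : Fin M → U) : Set Y :=
  {x | ∀ q : Fin M, c q = b → F q x ((Fin.cons u τ : Fin (M + 1) → U) q.castSucc) = τ q}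

theorem isRectangular_trajectory [MeasurableSpace U] [MeasurableSingletonClass U]
    [MeasurableSpace Y] (hF : ∀ q v, Measurable fun y => F q y v) (c : ℕ → B) :
    IsRectangular (fun (X : B → Y) (q : Fin M) => trajectory F u (fun q => X (c q)) (q + 1))
      (compatibleInputs F u c) where
  measurableSet b τ := by
    simp only [compatibleInputs, Set.ofPred_forall]
    exact .iInter fun q => .iInter fun _ => hF q _ (measurableSet_singleton (τ q))
  eq_iff X τ := by
    have hstates : (∀ q : Fin (M + 1), trajectory F u (fun q => X (c q)) q =
        (Fin.cons u τ : Fin (M + 1) → U) q) ↔ ∀ q : Fin M,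
          F q (X (c q)) ((Fin.cons u τ : Fin (M + 1) → U) q.castSucc) = τ q := by
      refine ⟨fun h q => ?_, fun h q => ?_⟩
      · rw [← h q.castSucc]
        exact h q.succ
      · induction q using Fin.induction with
        | zero => rfl
        | succ q ih => rw [Fin.cons_succ, ← h q, ← ih]; rfl
    refine Iff.trans ?_ (hstates.trans ⟨fun h b q hq => hq ▸ h q, fun h q => h (c q) q rfl⟩)
    rw [Fin.forall_fin_succ, funext_iff]
    simp [trajectory]

end Trajectory

/-! ### Cutting the samples into blocks -/

section Blocks

variable {Ω : Type*}

/-- The samples contained in `N` consecutive blocks of size `n`; only the first `t` of the `N * n`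
slots are used. -/
def unblock {N n t : ℕ} (htN : t ≤ N * n) (X : Fin N → Fin n → Ω) (j : Fin t) : Ω :=
  X (Fin.castLE htN j).divNat (Fin.castLE htN j).modNat

theorem measurePreserving_comp_injective [MeasurableSpace Ω] {I J : Type*} [Fintype I]
    [Fintype J] {e : J → I} (he : e.Injective) (ν : Measure Ω) [IsProbabilityMeasure ν] :
    MeasurePreserving (fun (x : I → Ω) j => x (e j)) (Measure.pi fun _ => ν)
      (Measure.pi fun _ => ν) := by
  refine ⟨measurable_pi_lambda _ fun j => measurable_pi_apply _, ?_⟩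
  have hindep := (ProbabilityTheory.iIndepFun_pi (μ := fun _ : I => ν) (X := fun _ => id)
    fun _ => aemeasurable_id).precomp he
  rw [(ProbabilityTheory.iIndepFun_iff_map_fun_eq_pi_map
    fun j => (measurable_pi_apply (e j)).aemeasurable).1 hindep]
  exact congrArg _ (funext fun j => (measurePreserving_eval (fun _ => ν) (e j)).map_eq)

theorem measurePreserving_uncurry [MeasurableSpace Ω] {B J : Type*} [Fintype B] [Fintype J]
    (ν : Measure Ω) [IsProbabilityMeasure ν] :
    MeasurePreserving (fun (X : B → J → Ω) p => X p.1 p.2)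
      (Measure.pi fun _ => Measure.pi fun _ => ν) (Measure.pi fun _ : B × J => ν) := by
  refine ⟨by fun_prop, ?_⟩
  have hmap := Measure.infinitePi_map_curry_symm fun (_ : B) (_ : J) => ν
  simp only [Measure.infinitePi_eq_pi] at hmap
  exact hmap

theorem measurePreserving_unblock [MeasurableSpace Ω] {N n t : ℕ} (htN : t ≤ N * n)
    (ν : Measure Ω) [IsProbabilityMeasure ν] :
    MeasurePreserving (unblock htN) (Measure.pi fun _ => Measure.pi fun _ => ν)
      (Measure.pi fun _ => ν) :=
  (measurePreserving_comp_injective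
    (finProdFinEquiv.symm.injective.comp (Fin.castLE_injective htN)) ν).comp
    (measurePreserving_uncurry ν)

/-- The starting time of the `q`-th block visit, when `t` samples are read in `N` blocks of
size `n`, repeatedly. The last blocks of a pass may be incomplete, whence the minimum. -/
def blockTime (t n N q : ℕ) : ℕ := q / N * t + min (q % N * n) t

variable {t n N : ℕ}

theorem blockTime_mul_add [NeZero N] (htN : t ≤ N * n) (p : ℕ) {r : ℕ} (hr : r ≤ N) :
    blockTime t n N (p * N + r) = p * t + min (r * n) t := by
  have hN := NeZero.pos N
  rcases hr.lt_or_eq with hr | rfl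
  · rw [blockTime, Nat.mul_add_mod_of_lt hr, mul_comm p N, Nat.mul_add_div hN,
      Nat.div_eq_of_lt hr, add_zero]
  · rw [← add_one_mul, min_eq_right htN, blockTime, Nat.mul_div_cancel _ hN, Nat.mul_mod_left]
    simp [add_one_mul]

theorem blockTime_mul [NeZero N] (ℓ : ℕ) : blockTime t n N (ℓ * N) = t * ℓ := by
  simp [blockTime, mul_comm, NeZero.pos N]

theorem blockTime_succ [NeZero N] (htN : t ≤ N * n) (q : ℕ) :
    blockTime t n N (q + 1) = q / N * t + min ((q % N + 1) * n) t := by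
  rw [← blockTime_mul_add htN _ (Nat.succ_le_of_lt (Nat.mod_lt q (NeZero.pos N))),
    Nat.succ_eq_add_one, ← add_assoc, Nat.div_add_mod']

theorem blockTime_le_succ [NeZero N] (htN : t ≤ N * n) (q : ℕ) :
    blockTime t n N q ≤ blockTime t n N (q + 1) := by
  rw [blockTime_succ htN, blockTime]
  gcongr
  exact Nat.le_succ _

theorem mod_div_eq_of_blockTime_le [NeZero N] (htN : t ≤ N * n) {q m : ℕ}
    (hm : blockTime t n N q ≤ m) (hm' : m < blockTime t n N (q + 1)) : m % t / n = q % N := by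
  rw [blockTime_succ htN] at hm'
  rw [blockTime] at hm
  obtain ⟨r, rfl⟩ := Nat.exists_eq_add_of_le (show q / N * t ≤ m by omega)
  rw [Nat.mul_add_mod_self_right, Nat.mod_eq_of_lt (show r < t by omega)]
  exact Nat.div_eq_of_lt_le (by omega) (by omega)

end Blocks

namespace StreamAlg

variable {Ω : Type*} [MeasurableSpace Ω] {s k : ℕ} (A : StreamAlg Ω s k)

theorem memory_eq_trajectory (y : ℕ → Ω) (j : ℕ) :
    A.memory y j = trajectory A.step A.init y j := by
  induction j with
  | zero => rfl
  | succ j ih => rw [memory, trajectory, ih]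

theorem measurable_run {t : ℕ} (ht : 1 ≤ t) (ℓ : ℕ) :
    Measurable (A.run ht ℓ : (Fin t → Ω) → Fin k) := by
  unfold run
  simp_rw [memory_eq_trajectory]
  exact (measurable_of_finite A.output).comp
    (measurable_trajectory A.measurable_step (fun j => measurable_pi_apply _) _)

/-- The effect on the memory of the `q`-th block visit, as a function of the block read. -/
def blockStep (A : StreamAlg Ω s k) (t n N : ℕ) [NeZero n] (q : ℕ) (x : Fin n → Ω)
    (u : Fin s → Bool) : Fin s → Bool :=
  trajectory (fun i => A.step (blockTime t n N q + i)) u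
    (fun i => x (Fin.ofNat n ((blockTime t n N q + i) % t)))
    (blockTime t n N (q + 1) - blockTime t n N q)

theorem measurable_blockStep (t n N : ℕ) [NeZero n] (q : ℕ) (u : Fin s → Bool) :
    Measurable fun x => A.blockStep t n N q x u :=
  measurable_trajectory (fun _ => A.measurable_step _) (fun _ => measurable_pi_apply _) _

variable {t n N : ℕ} [NeZero n] [NeZero N]

theorem memory_blockTime (ht : 1 ≤ t) (htN : t ≤ N * n) (X : Fin N → Fin n → Ω) (q : ℕ) :
    A.memory (fun j => unblock htN X ⟨j % t, Nat.mod_lt j ht⟩) (blockTime t n N q) =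
      trajectory (A.blockStep t n N) A.init (fun q => X (Fin.ofNat N q)) q := by
  induction q with
  | zero => simp [blockTime, memory, trajectory]
  | succ q ih =>
    have hle := blockTime_le_succ htN q
    rw [trajectory, ← ih, memory_eq_trajectory, ← Nat.add_sub_of_le hle, trajectory_add,
      ← memory_eq_trajectory, blockStep]
    refine trajectory_congr fun i hi => ?_
    have hblock := mod_div_eq_of_blockTime_le (q := q) htN (Nat.le_add_right _ i) (by omega)
    exact congrArg₂ X (Fin.ext hblock) rfl

/-- The output of the algorithm as a function of the memories at the ends of the block visits. -/
def transcriptOutput {M : ℕ} (τ : Fin M → Fin s → Bool) : Fin k :=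
  A.output ((Fin.cons A.init τ : Fin (M + 1) → Fin s → Bool) (Fin.last M))

theorem transcriptOutput_trajectory (ht : 1 ≤ t) (htN : t ≤ N * n) (ℓ : ℕ)
    (X : Fin N → Fin n → Ω) :
    A.transcriptOutput (fun q : Fin (ℓ * N) =>
      trajectory (A.blockStep t n N) A.init (fun q => X (Fin.ofNat N q)) (q + 1)) =
        A.run ht ℓ (unblock htN X) := by
  have hcons : ∀ q : Fin (ℓ * N + 1), (Fin.cons A.init fun q : Fin (ℓ * N) =>
      trajectory (A.blockStep t n N) A.init (fun q => X (Fin.ofNat N q)) (q + 1) :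
        Fin (ℓ * N + 1) → Fin s → Bool) q =
      trajectory (A.blockStep t n N) A.init (fun q => X (Fin.ofNat N q)) q :=
    Fin.cases rfl fun q => rfl
  rw [transcriptOutput, hcons, run, ← blockTime_mul (t := t) (n := n) (N := N),
    A.memory_blockTime ht, Fin.val_last]

end StreamAlg

/-! ### Centered families -/

section RelativeDensity

variable {Ω : Type*} [MeasurableSpace Ω] {ρ : ℝ} {μ₀ : Measure Ω}

/-- The function `g` with `dν/dμ₀ = 1 + ρ g`. Since `Measure.rnDeriv` is determined only almost
everywhere, the values are clipped so as to lie in `[-1, 1]` at every point. -/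
noncomputable def relativeDensity (ρ : ℝ) (μ₀ ν : Measure Ω) (a : Ω) : ℝ :=
  max (-1) (min 1 (((ν.rnDeriv μ₀ a).toReal - 1) / ρ))

theorem measurable_relativeDensity (ν : Measure Ω) : Measurable (relativeDensity ρ μ₀ ν) := by
  have := ν.measurable_rnDeriv μ₀
  unfold relativeDensity
  fun_prop

theorem abs_relativeDensity_le_one (ν : Measure Ω) (a : Ω) : |relativeDensity ρ μ₀ ν a| ≤ 1 :=
  abs_le.2 ⟨le_max_left _ _, max_le (by norm_num) (min_le_left _ _)⟩

theorem rpow_neg_div_two_mul_rpow_neg_mul_abs {x y : ℝ} (hx : 0 ≤ x) (hy : 0 < y) (m : ℕ)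
    (c : ℝ) : x ^ (-(m : ℝ) / 2) * y ^ (-(m : ℝ)) * |y ^ m * c| = (1 / √x) ^ m * |c| := by
  have hxm : x ^ (-(m : ℝ) / 2) = (1 / √x) ^ m := by
    rw [neg_div, div_eq_inv_mul, Real.rpow_neg hx, Real.rpow_mul hx, Real.rpow_natCast,
      ← one_div (2 : ℝ), ← Real.sqrt_eq_rpow, one_div, inv_pow]
  rw [hxm, Real.rpow_neg hy.le, Real.rpow_natCast, abs_mul, abs_of_pos (pow_pos hy m)]
  field_simp

theorem sum_filter_card_lt_two {I : Type*} [Fintype I] {F : Finset I → ℝ}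
    (hF : ∀ i, F {i} = 0) : ∑ S with ¬ 2 ≤ S.card, F S = F ∅ := by
  refine Finset.sum_eq_single_of_mem ∅ (by simp) fun S hS hne => ?_
  have hpos := Finset.card_pos.2 (Finset.nonempty_iff_ne_empty.2 hne)
  obtain ⟨i, rfl⟩ := Finset.card_eq_one.1 (le_antisymm
    (Nat.le_of_lt_succ (not_le.1 (Finset.mem_filter.1 hS).2)) hpos)
  exact hF i

variable {k : ℕ} {μ : Fin k → Measure Ω}

namespace IsCenteredFamily

theorem absolutelyContinuous (h : IsCenteredFamily ρ μ₀ μ) (i : Fin k) : μ i ≪ μ₀ := by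
  have := h.prob i
  refine .mk fun E hE h0 => (measureReal_eq_zero_iff).1 (le_antisymm ?_ measureReal_nonneg)
  simpa [measureReal_def, h0] using h.upper i E hE

theorem ae_rnDeriv_mem_Icc (h : IsCenteredFamily ρ μ₀ μ) (i : Fin k) :
    ∀ᵐ a ∂μ₀, ((μ i).rnDeriv μ₀ a).toReal ∈ Set.Icc (1 - ρ) (1 + ρ) := by
  have := h.prob_center
  have := h.prob i
  have hset : ∀ c E, ∫ _ in E, c ∂μ₀ = c * μ₀.real E := fun c E => by
    rw [setIntegral_const, smul_eq_mul, mul_comm]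
  refine Filter.Eventually.and
    (ae_le_of_forall_setIntegral_le (integrable_const _) Measure.integrable_toReal_rnDeriv
      fun E hE _ => ?_)
    (ae_le_of_forall_setIntegral_le Measure.integrable_toReal_rnDeriv (integrable_const _)
      fun E hE _ => ?_)
  · rw [Measure.setIntegral_toReal_rnDeriv (h.absolutelyContinuous i), hset]
    exact h.lower i E hE
  · rw [Measure.setIntegral_toReal_rnDeriv (h.absolutelyContinuous i), hset]
    exact h.upper i E hE

theorem ae_rnDeriv_eq (h : IsCenteredFamily ρ μ₀ μ) (i : Fin k) :
    ∀ᵐ a ∂μ₀, ((μ i).rnDeriv μ₀ a).toReal = 1 + ρ * relativeDensity ρ μ₀ (μ i) a := by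
  have hρ := h.rho_pos
  filter_upwards [h.ae_rnDeriv_mem_Icc i] with a ⟨hlow, hup⟩
  have hle : (((μ i).rnDeriv μ₀ a).toReal - 1) / ρ ≤ 1 := by
    rw [div_le_one hρ]; linarith
  have hge : -1 ≤ (((μ i).rnDeriv μ₀ a).toReal - 1) / ρ := by
    rw [le_div_iff₀ hρ]; linarith
  rw [relativeDensity, min_eq_right hle, max_eq_right hge, mul_div_cancel₀ _ hρ.ne']
  ring

theorem perturb_relativeDensity (h : IsCenteredFamily ρ μ₀ μ) (i : Fin k) :
    perturb μ₀ ρ (relativeDensity ρ μ₀ (μ i)) = μ i := by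
  have := h.prob_center
  have := h.prob i
  refine (withDensity_congr_ae ?_).trans
    (Measure.withDensity_rnDeriv_eq (μ i) μ₀ (h.absolutelyContinuous i))
  filter_upwards [h.ae_rnDeriv_eq i, Measure.rnDeriv_lt_top (μ i) μ₀] with a ha htop
  rw [← ha, ENNReal.ofReal_toReal htop.ne]

theorem highOrderCorr_eq (h : IsCenteredFamily ρ μ₀ μ) (S : Finset (Fin k)) :
    highOrderCorr μ₀ μ S = ρ ^ S.card * ∫ a, ∏ i ∈ S, relativeDensity ρ μ₀ (μ i) a ∂μ₀ := by
  rw [highOrderCorr, ← integral_const_mul]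
  refine integral_congr_ae ?_
  filter_upwards [ae_all_iff.2 h.ae_rnDeriv_eq] with a ha
  simp_rw [ha, add_sub_cancel_left, Finset.prod_mul_distrib, Finset.prod_const]

theorem integral_relativeDensity (h : IsCenteredFamily ρ μ₀ μ) (hρ : ρ ≤ 1 / 2) (i : Fin k) :
    ∫ a, relativeDensity ρ μ₀ (μ i) a ∂μ₀ = 0 := by
  have := h.prob_center
  have := h.prob i
  have hone := measureReal_perturb_univ (μ₀ := μ₀)
    (measurable_relativeDensity (ρ := ρ) (μ₀ := μ₀) (μ i))
    (abs_relativeDensity_le_one (μ i)) (abs_le.2 ⟨by linarith [h.rho_pos], hρ⟩)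
  rw [h.perturb_relativeDensity, probReal_univ, left_eq_add] at hone
  exact (mul_eq_zero.1 hone).resolve_left h.rho_pos.ne'

theorem isNearlyIndependent (h : IsCenteredFamily ρ μ₀ μ) (hρ : ρ ≤ 1 / 2) {n : ℕ}
    (hcorr : ApproxUncorrelated ρ μ₀ μ n) :
    IsNearlyIndependent μ₀ (fun i => relativeDensity ρ μ₀ (μ i)) n where
  measurable i := measurable_relativeDensity (μ i)
  abs_le_one i := abs_relativeDensity_le_one (μ i)
  integral_eq_zero := h.integral_relativeDensity hρ
  sum_le := by
    have := h.prob_center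
    rw [← Finset.sum_filter_not_add_sum_filter _ fun S : Finset (Fin k) => 2 ≤ S.card]
    refine add_le_add ?_ (le_trans (le_of_eq ?_) hcorr)
    · rw [sum_filter_card_lt_two fun i => by simp [h.integral_relativeDensity hρ]]
      simp
    · refine Finset.sum_congr rfl fun S _ => ?_
      rw [h.highOrderCorr_eq, rpow_neg_div_two_mul_rpow_neg_mul_abs n.cast_nonneg h.rho_pos]

theorem exists_isNearlyIndependent (h : IsCenteredFamily ρ μ₀ μ) (hρ : ρ ≤ 1 / 2) {n : ℕ}
    (hcorr : ApproxUncorrelated ρ μ₀ μ n) :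
    ∃ g : Fin k → Ω → ℝ, IsNearlyIndependent μ₀ g n ∧ μ = fun i => perturb μ₀ ρ (g i) :=
  ⟨_, h.isNearlyIndependent hρ hcorr, funext fun i => (h.perturb_relativeDensity i).symm⟩

end IsCenteredFamily

end RelativeDensity

/-! ### The lower bound -/

theorem log_card_transcripts_le (s ℓ N : ℕ) :
    Real.log (Fintype.card (Fin (ℓ * N) → Fin s → Bool)) ≤ s * ℓ * N := by
  simp only [Fintype.card_pi, Fintype.card_bool, Finset.prod_const, Finset.card_univ,
    Fintype.card_fin, Nat.cast_pow, Real.log_pow, Nat.cast_mul, Nat.cast_ofNat]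
  calc (ℓ * N * (s * Real.log 2) : ℝ) = s * ℓ * N * Real.log 2 := by ring
    _ ≤ s * ℓ * N :=
      mul_le_of_le_one_right (by positivity) (Real.log_two_lt_d9.le.trans (by norm_num))

theorem exists_mul_mem_Icc {n t : ℕ} (hn : 1 ≤ n) (hnt : n ≤ t) :
    ∃ N, 1 ≤ N ∧ N * n ∈ Set.Icc t (2 * t) := by
  refine ⟨t / n + 1, Nat.succ_pos _, ?_, ?_⟩ <;> rw [add_one_mul]
  · exact (Nat.lt_div_mul_add hn).le
  · linarith [Nat.div_mul_le_self t n]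

section Parameters

variable {k n : ℕ} {ρ : ℝ}

theorem mul_sq_le_of_mul_sq_mul_log_le (hk : 2 ≤ k) (h : n * ρ ^ 2 * Real.log k ≤ 1 / 1024) :
    n * ρ ^ 2 ≤ 1 / 512 := by
  have hlog := mul_le_mul_of_nonneg_left (half_le_log hk) (show 0 ≤ n * ρ ^ 2 by positivity)
  linarith

theorem le_half_of_mul_sq_le (hn : 1 ≤ n) (h : n * ρ ^ 2 ≤ 1 / 512) : ρ ≤ 1 / 2 := by
  have hn' : (1 : ℝ) ≤ n := by exact_mod_cast hn
  have hsq : ρ ^ 2 ≤ (1 / 2) ^ 2 := by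
    linarith [le_mul_of_one_le_left (sq_nonneg ρ) hn']
  exact le_of_sq_le_sq hsq (by norm_num)

theorem mul_sqrt_le_of_mul_sq_le (h : n * ρ ^ 2 ≤ 1 / 512) : ρ * √n ≤ 1 / 16 := by
  refine le_of_sq_le_sq ?_ (by norm_num)
  rw [mul_pow, Real.sq_sqrt n.cast_nonneg]
  linarith

end Parameters

namespace StreamAlg.Identifies

variable {Ω : Type*} [MeasurableSpace Ω] {k s t n ℓ N : ℕ} {ht : 1 ≤ t} {A : StreamAlg Ω s k}

theorem measureReal_transcriptOutput_eq {μ : Fin k → Measure Ω} [∀ i, IsProbabilityMeasure (μ i)]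
    [NeZero n] [NeZero N] {ε : ℝ} (hA : A.Identifies ht ℓ μ ε) (htN : t ≤ N * n) (i : Fin k) :
    1 - ε ≤ (Measure.pi fun _ : Fin N => Measure.pi fun _ : Fin n => μ i).real
      {X | A.transcriptOutput (fun q : Fin (ℓ * N) => trajectory (A.blockStep t n N) A.init
        (fun q => X (Fin.ofNat N q)) (q + 1)) = i} := by
  have hrun := (A.measurable_run ht ℓ (measurableSet_singleton i)).nullMeasurableSet
    (μ := Measure.pi fun _ => μ i)
  simp_rw [A.transcriptOutput_trajectory ht htN]
  exact (hA i).trans_eq ((measurePreserving_unblock htN (μ i)).measureReal_preimage hrun).symm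

variable {μ₀ : Measure Ω} [IsProbabilityMeasure μ₀] {g : Fin k → Ω → ℝ} {ρ : ℝ}

theorem le_of_mul_sq_le
    (hA : A.Identifies ht ℓ (fun i => perturb μ₀ ρ (g i)) (1 / 3)) (hk : 2 ≤ k)
    (h : IsNearlyIndependent μ₀ g n) (hρ0 : 0 < ρ) (hρ : ρ ≤ 1 / 2)
    (hnρ : n * ρ ^ 2 ≤ 1 / 200) : n ≤ t := by
  have hsamples := le_sq_mul_card_of_identifies (by rwa [Fintype.card_fin]) h.measurable
    h.abs_le_one h.integral_eq_zero (abs_le.2 ⟨by linarith, hρ⟩)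
    (fun i => A.measurable_run ht ℓ (measurableSet_singleton i))
    (fun i => le_trans (by norm_num) (hA i))
  rw [Fintype.card_fin] at hsamples
  have hle : ρ ^ 2 * n ≤ ρ ^ 2 * t := by linarith
  exact_mod_cast le_of_mul_le_mul_left hle (by positivity)

theorem card_div_le [NeZero n] [NeZero N]
    (hA : A.Identifies ht ℓ (fun i => perturb μ₀ ρ (g i)) (1 / 3)) (hk : 2 ≤ k)
    (h : IsNearlyIndependent μ₀ g n) (hρ : 0 < ρ) (hρn : ρ * √n ≤ 1 / 16)
    (hρk : n * ρ ^ 2 * Real.log k ≤ 1 / 64) (htN : t ≤ N * n) :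
    (k : ℝ) / 100 ≤ 131072 * (n * ρ ^ 2 * Real.log k) * (s * ℓ * N + 2 * N) := by
  have hρ2 : |ρ| ≤ 1 / 2 :=
    abs_le_half_of_mul_sqrt_card_le (J := Fin n) hρ.le (by rw [Fintype.card_fin]; linarith)
  have := h.isProbabilityMeasure_perturb hρ2
  have hsq : (ρ * √n) ^ 2 = n * ρ ^ 2 := by
    rw [mul_pow, Real.sq_sqrt n.cast_nonneg, mul_comm]
  have hcard := (isRectangular_trajectory (M := ℓ * N) (u := A.init)
    (A.measurable_blockStep t n N) (Fin.ofNat N)).card_le_of_identifies (J := Fin n)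
    (g := g) (by rwa [Fintype.card_fin]) hρ (by rwa [Fintype.card_fin])
    (by rwa [Fintype.card_fin]) (by rwa [Fintype.card_fin, Fintype.card_fin, hsq])
    A.transcriptOutput fun i =>
      le_trans (by norm_num) (hA.measureReal_transcriptOutput_eq htN i)
  simp only [Fintype.card_fin, hsq] at hcard
  refine hcard.trans ?_
  gcongr
  exact log_card_transcripts_le s ℓ N

theorem card_le (hA : A.Identifies ht ℓ (fun i => perturb μ₀ ρ (g i)) (1 / 3)) (hk : 2 ≤ k)
    (hs : 1 ≤ s) (hℓ : 1 ≤ ℓ) (hn : 1 ≤ n) (h : IsNearlyIndependent μ₀ g n) (hρ : 0 < ρ)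
    (hρk : n * ρ ^ 2 * Real.log k ≤ 1 / 1024) :
    (k : ℝ) ≤ t * s * ℓ * (10 ^ 8 * ρ ^ 2 * Real.log k) := by
  have hnρ := mul_sq_le_of_mul_sq_mul_log_le hk hρk
  have hnt := hA.le_of_mul_sq_le hk h hρ (le_half_of_mul_sq_le hn hnρ) (by linarith)
  obtain ⟨N, hN, htN, hNt⟩ := exists_mul_mem_Icc hn hnt
  have : NeZero n := ⟨Nat.one_le_iff_ne_zero.1 hn⟩
  have : NeZero N := ⟨Nat.one_le_iff_ne_zero.1 hN⟩
  have hNsℓ : (N : ℝ) ≤ s * ℓ * N :=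
    le_mul_of_one_le_left N.cast_nonneg (by exact_mod_cast Nat.mul_pos hs hℓ)
  have hNt' : (N * n : ℝ) ≤ 2 * t := by exact_mod_cast hNt
  have hcard := hA.card_div_le hk h hρ (mul_sqrt_le_of_mul_sq_le hnρ) (by linarith) htN
  calc (k : ℝ) = 100 * (k / 100) := by ring
    _ ≤ 100 * (131072 * (n * ρ ^ 2 * Real.log k) * (s * ℓ * N + 2 * (s * ℓ * N))) := by
      gcongr; exact hcard.trans (by gcongr)
    _ = 39321600 * (ρ ^ 2 * Real.log k * s * ℓ) * (N * n) := by ring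
    _ ≤ 39321600 * (ρ ^ 2 * Real.log k * s * ℓ) * (2 * t) := by gcongr
    _ = 78643200 * (t * s * ℓ * (ρ ^ 2 * Real.log k)) := by ring
    _ ≤ 10 ^ 8 * (t * s * ℓ * (ρ ^ 2 * Real.log k)) := by gcongr; norm_num
    _ = t * s * ℓ * (10 ^ 8 * ρ ^ 2 * Real.log k) := by ring

end StreamAlg.Identifies

theorem theorem2 :
    ∃ C₂ C₃ : ℝ, 0 < C₂ ∧ 0 < C₃ ∧
      ∀ (Ω : Type*) [MeasurableSpace Ω] (k : ℕ) (ρ : ℝ)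
        (μ₀ : MeasureTheory.Measure Ω) (μ : Fin k → MeasureTheory.Measure Ω),
        IsCenteredFamily ρ μ₀ μ →
        (∃ n : ℕ, 1 ≤ n ∧ (n : ℝ) ≤ C₂ / (ρ ^ 2 * Real.log k) ∧
          ApproxUncorrelated ρ μ₀ μ n) →
        ∀ (t s ℓ : ℕ) (ht : 1 ≤ t), 1 ≤ s → 1 ≤ ℓ →
          ∀ A : StreamAlg Ω s k, A.Identifies ht ℓ μ (1 / 3) →
            (k : ℝ) / (C₃ * ρ ^ 2 * Real.log k) ≤ (t : ℝ) * s * ℓ := by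
  refine ⟨1 / 1024, 10 ^ 8, by norm_num, by norm_num, ?_⟩
  intro Ω _ k ρ μ₀ μ hμ ⟨n, hn, hnC, hcorr⟩ t s ℓ ht hs hℓ A hA
  have := hμ.prob_center
  have hρ := hμ.rho_pos
  have hk := hμ.two_le
  have hlog := half_le_log hk
  have hnk : n * ρ ^ 2 * Real.log k ≤ 1 / 1024 := by
    rwa [mul_assoc, ← le_div_iff₀ (by positivity)]
  have hρ_half := le_half_of_mul_sq_le hn (mul_sq_le_of_mul_sq_mul_log_le hk hnk)
  obtain ⟨g, hg, rfl⟩ := hμ.exists_isNearlyIndependent hρ_half hcorr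
  rw [div_le_iff₀ (by positivity)]
  exact hA.card_le hk hs hℓ hn hg hρ hnk
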